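/- Let $q$ be a complex number with $0<|q|<1$. Write $$(x;q)_n=\prod_{i=0}^{n-1}(1-q^ix),\qquad (x;q)_\infty=\prod_{i\ge 0}(1-q^ix),\qquad j(x;q)=(x;q)_\infty(q/x;q)_\infty(q;q)_\infty,$$ and, for integers $a$ and $m\ge 1$, $$J_{a,m}=j(q^a;q^m),\qquad \overline{J}_{a,m}=j(-q^a;q^m),\qquad J_m=J_{m,3m}=\prod_{i\ge 1}(1-q^{mi}).$$ Let $$g(x,q)=x^{-1}\Big(-1+\sum_{n=0}^{\infty}\frac{q^{n^2}}{(x;q)_{n+1}(q/x;q)_n}\Big)$$ be the universal mock theta function, and let $$\overline{\phi}_0(q)=\sum_{n=0}^{\infty}q^n(-q;q)_{2n+1},\qquad \overline{\phi}_1(q)=\sum_{n=0}^{\infty}q^n(-q;q)_{2n}$$ be the mock theta functions of Bringmann, Hikami and Lovejoy. Then all the series below converge, no denominator vanishes, and $$q\,\overline{\phi}_0(q)=-1+q\,g(-q,q^8)+\frac{\overline{J}_{2,4}\,\overline{J}_{3,8}}{J_2},$$ $$\overline{\phi}_1(q)=-q^2\,g(-q^3,q^8)+\frac{\overline{J}_{2,4}\,\overline{J}_{1,8}}{J_2}.$$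 -/

import Mathlib

namespace MockTheta

/-- The finite `q`-shifted factorial `(x; q)_n`. -/
noncomputable def qPoch (x q : ℂ) (n : ℕ) : ℂ :=
  ∏ i ∈ Finset.range n, (1 - q ^ i * x)

/-- The infinite `q`-shifted factorial `(x; q)_∞`. -/
noncomputable def qPochInf (x q : ℂ) : ℂ :=
  ∏' i : ℕ, (1 - q ^ i * x)

/-- The product defining `(x; q)_∞` converges for `|q| < 1`, so `qPochInf` is not a junk value. -/
theorem multipliable_qPochInf (x q : ℂ) (hq : ‖q‖ < 1) :
    Multipliable (fun i : ℕ => 1 - q ^ i * x) := by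
  have h : Summable (fun i : ℕ => ‖-(q ^ i * x)‖) := by
    simp only [norm_neg, norm_mul, norm_pow]
    exact (summable_geometric_of_lt_one (norm_nonneg q) hq).mul_right _
  simpa [sub_eq_add_neg] using multipliable_one_add_of_summable h

/-- The theta function `j(x; q) = (x; q)_∞ (q/x; q)_∞ (q; q)_∞`. -/
noncomputable def theta (x q : ℂ) : ℂ :=
  qPochInf x q * qPochInf (q / x) q * qPochInf q q

/-- `J_{a,m} = j(q^a; q^m)`. -/
noncomputable def J (a : ℤ) (m : ℕ) (q : ℂ) : ℂ :=
  theta (q ^ a) (q ^ m)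

/-- `J̄_{a,m} = j(-q^a; q^m)`. -/
noncomputable def Jbar (a : ℤ) (m : ℕ) (q : ℂ) : ℂ :=
  theta (-q ^ a) (q ^ m)

/-- `J_m = J_{m,3m}`. -/
noncomputable def Jsingle (m : ℕ) (q : ℂ) : ℂ :=
  J m (3 * m) q

/-- The denominator `(x; q)_{n+1} (q/x; q)_n` in the series for `g(x, q)`. -/
noncomputable def gDenom (x q : ℂ) (n : ℕ) : ℂ :=
  qPoch x q (n + 1) * qPoch (q / x) q n

/-- The universal mock theta function
`g(x, q) = x⁻¹ (-1 + ∑_{n ≥ 0} q^{n²} / ((x; q)_{n+1} (q/x; q)_n))`. -/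
noncomputable def g (x q : ℂ) : ℂ :=
  x⁻¹ * (-1 + ∑' n : ℕ, q ^ (n ^ 2) / gDenom x q n)

/-- The expression defining `g(x, q)` makes sense: there is no division by zero
and the series converges. -/
def GDefined (x q : ℂ) : Prop :=
  x ≠ 0 ∧ (∀ n : ℕ, gDenom x q n ≠ 0) ∧ Summable (fun n : ℕ => q ^ (n ^ 2) / gDenom x q n)

/-- The general term of `φ̄₀(q)`. -/
noncomputable def phiBar0Term (q : ℂ) (n : ℕ) : ℂ :=
  q ^ n * qPoch (-q) q (2 * n + 1)

/-- The general term of `φ̄₁(q)`. -/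
noncomputable def phiBar1Term (q : ℂ) (n : ℕ) : ℂ :=
  q ^ n * qPoch (-q) q (2 * n)

/-- `φ̄₀(q) = ∑_{n ≥ 0} q^n (-q; q)_{2n+1}`. -/
noncomputable def phiBar0 (q : ℂ) : ℂ :=
  ∑' n : ℕ, phiBar0Term q n

/-- `φ̄₁(q) = ∑_{n ≥ 0} q^n (-q; q)_{2n}`. -/
noncomputable def phiBar1 (q : ℂ) : ℂ :=
  ∑' n : ℕ, phiBar1Term q n

end MockTheta

namespace MockTheta
open Filter Topology

/-! Fix p with p² = q. The even and odd terms of F = ∑ pⁿ (-q; q)_n are those of φ̄₁(q) and p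
φ̄₀(q), so q φ̄₀(q) + p φ̄₁(q) = pF (`sq_mul_phiBar0_add`). Iterating the functional equation in t
of ∑ tⁿ (-q; q)_n turns 1 + pF into ∑ p^{n²} / (p; p²)_n, and adding its terms in pairs produces the
series of g(p, p⁴); thus pF = p g(p, p⁴) (`mul_tsum_fineTerm_eq_g`).

It remains to split p g(p, p⁴) by parity in p. Partial fractions and the Durfee rectangle identity
give g(x, q) = (q; q)_∞⁻¹ ∑ (-1)ⁿ q^{3n(n+1)/2} / (1 - xqⁿ) (`g_eq_appell`). The combination
`appellComb` of such series in bases q and q⁴ has simple poles, all of them zeros of `thetaProd`,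
and under x ↦ qx the two functions acquire inverse multipliers. Their product is therefore
q-periodic with removable singularities on the punctured plane, hence constant by Liouville, and the
constant is read off at x = 1 (`thetaProd_mul_appellComb`).

With base p⁴ and x = p, this relation, a product identity and the dissection of j(-p; p⁴) express p
g(p, p⁴) through functions of p² and explicit odd powers of p (`mul_g_self_eq`). Replacing p by -p
and taking half the sum and half the difference separates the two identities. -/

/-- The triangular numbers `n (n + 1) / 2`, extended to the integers. -/
def tri (n : ℤ) : ℤ := n * (n + 1) / 2

theorem two_mul_tri (n : ℤ) : 2 * tri n = n * (n + 1) :=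
  Int.mul_ediv_cancel' (Int.even_mul_succ_self n).two_dvd

theorem tri_add (m n : ℤ) : tri (m + n) = tri m + tri n + m * n := by
  have h := two_mul_tri (m + n)
  have h1 := two_mul_tri m
  have h2 := two_mul_tri n
  linarith

theorem tri_one : tri 1 = 1 := rfl

theorem tri_zero : tri 0 = 0 := rfl

theorem tri_neg (n : ℤ) : tri (-n) = tri n - n := by
  have h := two_mul_tri (-n)
  have h1 := two_mul_tri n
  linarith

/-! ### Convergence of theta-type series and basic facts on q-shifted factorials -/

theorem summable_norm_tri_mul_nat {q : ℂ} (hq1 : ‖q‖ < 1) (hq0 : q ≠ 0) {x : ℂ} (hx : x ≠ 0) :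
    Summable (fun n : ℕ => ‖q ^ tri n * x ^ (n : ℤ)‖) := by
  refine summable_of_ratio_test_tendsto_lt_one (l := 0) one_pos ?_ ?_
  · exact Eventually.of_forall fun n =>
      norm_ne_zero_iff.2 (mul_ne_zero (zpow_ne_zero _ hq0) (zpow_ne_zero _ hx))
  · have h : ∀ n : ℕ, ‖‖q ^ tri ((n + 1 : ℕ) : ℤ) * x ^ ((n + 1 : ℕ) : ℤ)‖‖ /
        ‖‖q ^ tri n * x ^ (n : ℤ)‖‖ = ‖q‖ ^ n * (‖q‖ * ‖x‖) := by
      intro n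
      have e : q ^ tri ((n + 1 : ℕ) : ℤ) * x ^ ((n + 1 : ℕ) : ℤ) =
          (q ^ tri n * x ^ (n : ℤ)) * (q ^ n * (q * x)) := by
        rw [Nat.cast_add, Nat.cast_one, tri_add, tri_one, mul_one, zpow_add₀ hq0, zpow_add₀ hq0,
          zpow_add₀ hx]
        simp only [zpow_natCast, zpow_one]
        ring
      rw [e, norm_norm, norm_norm, norm_mul (q ^ tri n * x ^ (n : ℤ)), mul_div_cancel_left₀]
      · simp [norm_pow]
      · exact norm_ne_zero_iff.2 (mul_ne_zero (zpow_ne_zero _ hq0) (zpow_ne_zero _ hx))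
    simp_rw [h]
    simpa using (tendsto_pow_atTop_nhds_zero_of_lt_one (norm_nonneg q) hq1).mul_const (‖q‖ * ‖x‖)

theorem summable_norm_tri_mul {q : ℂ} (hq1 : ‖q‖ < 1) (hq0 : q ≠ 0) {x : ℂ} (hx : x ≠ 0) :
    Summable (fun n : ℤ => ‖q ^ tri n * x ^ n‖) := by
  refine Summable.of_nat_of_neg (summable_norm_tri_mul_nat hq1 hq0 hx) ?_
  refine (summable_norm_tri_mul_nat hq1 hq0 (inv_ne_zero (mul_ne_zero hq0 hx))).congr fun n => ?_
  rw [tri_neg, zpow_sub₀ hq0, inv_zpow, mul_zpow, zpow_neg]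
  congr 1
  field_simp

theorem qPoch_succ (x q : ℂ) (n : ℕ) : qPoch x q (n + 1) = qPoch x q n * (1 - q ^ n * x) :=
  Finset.prod_range_succ _ _

theorem qPoch_succ' (x q : ℂ) (n : ℕ) : qPoch x q (n + 1) = (1 - x) * qPoch (q * x) q n := by
  rw [qPoch, Finset.prod_range_succ', mul_comm, qPoch]
  simp [pow_succ, mul_assoc]

theorem qPoch_zero (x q : ℂ) : qPoch x q 0 = 1 := rfl

theorem tendsto_qPoch {q : ℂ} (hq1 : ‖q‖ < 1) (x : ℂ) :
    Tendsto (qPoch x q) atTop (𝓝 (qPochInf x q)) :=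
  (multipliable_qPochInf x q hq1).hasProd.tendsto_prod_nat

theorem qPoch_ne_zero {x q : ℂ} (h : ∀ i : ℕ, q ^ i * x ≠ 1) (n : ℕ) : qPoch x q n ≠ 0 :=
  Finset.prod_ne_zero_iff.2 fun i _ => sub_ne_zero.2 (h i).symm

theorem qPochInf_ne_zero {x q : ℂ} (hq1 : ‖q‖ < 1) (h : ∀ i : ℕ, q ^ i * x ≠ 1) :
    qPochInf x q ≠ 0 := by
  have := tprod_one_add_ne_zero_of_summable (f := fun i : ℕ => -(q ^ i * x)) ?_ ?_
  · simpa [qPochInf, sub_eq_add_neg] using this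
  · intro i
    rw [← sub_eq_add_neg]
    exact sub_ne_zero.2 (h i).symm
  · simp only [norm_neg, norm_mul, norm_pow]
    exact (summable_geometric_of_lt_one (norm_nonneg q) hq1).mul_right _

theorem qPochInf_eq_mul {q : ℂ} (hq1 : ‖q‖ < 1) (x : ℂ) :
    qPochInf x q = (1 - x) * qPochInf (q * x) q := by
  refine tendsto_nhds_unique ((tendsto_qPoch hq1 x).comp (tendsto_add_atTop_nat 1)) ?_
  refine ((tendsto_qPoch hq1 (q * x)).const_mul (1 - x)).congr fun n => ?_
  simp [qPoch_succ']

theorem pow_mul_self_ne_one {q : ℂ} (hq1 : ‖q‖ < 1) (i : ℕ) : q ^ i * q ≠ 1 := by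
  intro h
  have h1 := congrArg norm h
  rw [← pow_succ, norm_pow, norm_one] at h1
  exact (pow_lt_one₀ (norm_nonneg q) hq1 (Nat.succ_ne_zero i)).ne h1

theorem qPochInf_self_ne_zero {q : ℂ} (hq1 : ‖q‖ < 1) : qPochInf q q ≠ 0 :=
  qPochInf_ne_zero hq1 (pow_mul_self_ne_one hq1)

theorem exists_norm_le_of_tendsto {u : ℕ → ℂ} {l : ℂ} (h : Tendsto u atTop (𝓝 l)) :
    ∃ M : ℝ, 0 ≤ M ∧ ∀ n, ‖u n‖ ≤ M := by
  obtain ⟨M, hM⟩ := h.norm.bddAbove_range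
  exact ⟨M, (norm_nonneg _).trans (hM ⟨0, rfl⟩), fun n => hM ⟨n, rfl⟩⟩

/-! ### Reciprocal q-factorials and Euler's expansion -/

/-- The reciprocal `1 / (q; q)_n`, extended by zero to negative `n`. -/
noncomputable def qFacInv (q : ℂ) (n : ℤ) : ℂ := if n < 0 then 0 else (qPoch q q n.toNat)⁻¹

theorem qFacInv_natCast (q : ℂ) (n : ℕ) : qFacInv q n = (qPoch q q n)⁻¹ := by
  simp [qFacInv]

theorem qFacInv_of_neg (q : ℂ) {n : ℤ} (h : n < 0) : qFacInv q n = 0 := by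
  simp [qFacInv, h]

theorem qFacInv_zero (q : ℂ) : qFacInv q 0 = 1 := by
  simp [qFacInv, qPoch_zero]

/-- The extension by zero is consistent with the recurrence even at n = 0, where 1 - q⁰ = 0. Hence
sums over all of ℤ can be shifted freely without boundary terms. -/
theorem qFacInv_sub_one {q : ℂ} (hq1 : ‖q‖ < 1) (n : ℤ) :
    qFacInv q (n - 1) = (1 - q ^ n) * qFacInv q n := by
  rcases lt_trichotomy n 0 with h | rfl | h
  · rw [qFacInv_of_neg q h, qFacInv_of_neg q (by omega), mul_zero]
  · simp [qFacInv]
  · obtain ⟨m, rfl⟩ : ∃ m : ℕ, n = m + 1 := ⟨(n - 1).toNat, by omega⟩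
    have h1 := qPoch_ne_zero (pow_mul_self_ne_one hq1) (m + 1)
    have e : ((m : ℤ) + 1) = ((m + 1 : ℕ) : ℤ) := by push_cast; rfl
    rw [add_sub_cancel_right, e, qFacInv_natCast, qFacInv_natCast, zpow_natCast]
    rw [qPoch_succ] at h1 ⊢
    have h2 := right_ne_zero_of_mul h1
    rw [mul_inv, pow_succ]
    field_simp

theorem tendsto_qFacInv {q : ℂ} (hq1 : ‖q‖ < 1) :
    Tendsto (fun n : ℕ => qFacInv q n) atTop (𝓝 (qPochInf q q)⁻¹) := by
  simp_rw [qFacInv_natCast]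
  exact (tendsto_qPoch hq1 q).inv₀ (qPochInf_self_ne_zero hq1)

theorem exists_norm_qFacInv_le {q : ℂ} (hq1 : ‖q‖ < 1) :
    ∃ M : ℝ, 0 ≤ M ∧ ∀ n, ‖qFacInv q n‖ ≤ M := by
  obtain ⟨M, h0, hM⟩ := exists_norm_le_of_tendsto (tendsto_qFacInv hq1)
  refine ⟨M, h0, fun n => ?_⟩
  rcases lt_or_ge n 0 with h | h
  · simpa [qFacInv_of_neg q h] using h0
  · lift n to ℕ using h
    exact hM n

/-- The general term of Euler's expansion of `(-q y; q)_∞`. -/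
noncomputable def eulerTerm (q y : ℂ) (a : ℤ) : ℂ := q ^ tri a * y ^ a * qFacInv q a

theorem summable_norm_eulerTerm {q : ℂ} (hq1 : ‖q‖ < 1) (hq0 : q ≠ 0) {y : ℂ} (hy : y ≠ 0) :
    Summable (fun a => ‖eulerTerm q y a‖) := by
  obtain ⟨M, h0, hM⟩ := exists_norm_qFacInv_le hq1
  refine Summable.of_nonneg_of_le (fun _ => norm_nonneg _) (fun a => ?_)
    ((summable_norm_tri_mul hq1 hq0 hy).mul_right M)
  rw [eulerTerm, norm_mul]
  exact mul_le_mul_of_nonneg_left (hM a) (norm_nonneg _)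

/-- Shifting the index by one identifies the difference of the two series with q y times the second.
-/
theorem tsum_eulerTerm_eq_mul {q : ℂ} (hq1 : ‖q‖ < 1) (hq0 : q ≠ 0) {y : ℂ} (hy : y ≠ 0) :
    ∑' a, eulerTerm q y a = (1 + q * y) * ∑' a, eulerTerm q (q * y) a := by
  have h1 := (summable_norm_eulerTerm hq1 hq0 hy).of_norm
  have h2 := (summable_norm_eulerTerm hq1 hq0 (mul_ne_zero hq0 hy)).of_norm
  have key : ∀ a, eulerTerm q y (a + 1) - eulerTerm q (q * y) (a + 1) =
      q * y * eulerTerm q (q * y) a := by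
    intro a
    have h := qFacInv_sub_one hq1 (a + 1)
    rw [add_sub_cancel_right] at h
    simp only [eulerTerm, tri_add, tri_one, mul_one, mul_zpow, zpow_add₀ hq0, zpow_add₀ hy, zpow_one]
      at h ⊢
    rw [h]
    ring
  have h3 := (Equiv.addRight (1 : ℤ)).tsum_eq (fun a => eulerTerm q y a - eulerTerm q (q * y) a)
  simp only [Equiv.coe_addRight, key, tsum_mul_left] at h3
  rw [h1.tsum_sub h2] at h3
  linear_combination -h3

theorem tendsto_tsum_eulerTerm {q : ℂ} (hq1 : ‖q‖ < 1) (hq0 : q ≠ 0) {y : ℂ} (hy : y ≠ 0) :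
    Tendsto (fun n : ℕ => ∑' a, eulerTerm q (q ^ n * y) a) atTop (𝓝 1) := by
  have h1 : ∑' a : ℤ, (if a = 0 then (1 : ℂ) else 0) = 1 := by simp
  rw [← h1]
  refine tendsto_tsum_of_dominated_convergence (summable_norm_eulerTerm hq1 hq0 hy) ?_ ?_
  · intro a
    rcases lt_trichotomy a 0 with h | rfl | h
    · simp [eulerTerm, qFacInv_of_neg q h, h.ne]
    · simp [eulerTerm, tri_zero, qFacInv_zero]
    · lift a to ℕ using h.le
      have ha : a ≠ 0 := by omega
      have e : ∀ n : ℕ, eulerTerm q (q ^ n * y) a = (q ^ a) ^ n * eulerTerm q y a := by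
        intro n
        simp only [eulerTerm, zpow_natCast, mul_pow]
        ring
      simp_rw [e]
      have : ‖q ^ a‖ < 1 := by
        rw [norm_pow]
        exact pow_lt_one₀ (norm_nonneg q) hq1 ha
      simpa [h.ne', ha] using
        (tendsto_pow_atTop_nhds_zero_of_norm_lt_one this).mul_const (eulerTerm q y a)
  · refine Eventually.of_forall fun n a => ?_
    rcases lt_or_ge a 0 with h | h
    · simp [eulerTerm, qFacInv_of_neg q h]
    · lift a to ℕ using h
      have e : eulerTerm q (q ^ n * y) a = (q ^ n) ^ a * eulerTerm q y a := by
        simp only [eulerTerm, zpow_natCast, mul_pow]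
        ring
      rw [e, norm_mul, norm_pow, norm_pow]
      exact mul_le_of_le_one_left (norm_nonneg _)
        (pow_le_one₀ (by positivity) (pow_le_one₀ (norm_nonneg q) hq1.le))

/-- Euler's expansion of an infinite `q`-shifted factorial. -/
theorem qPochInf_eq_tsum_eulerTerm {q : ℂ} (hq1 : ‖q‖ < 1) (hq0 : q ≠ 0) {y : ℂ} (hy : y ≠ 0) :
    qPochInf (-(q * y)) q = ∑' a, eulerTerm q y a := by
  have h : ∀ n : ℕ, qPoch (-(q * y)) q n * ∑' a, eulerTerm q (q ^ n * y) a =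
      ∑' a, eulerTerm q y a := by
    intro n
    induction n with
    | zero => simp [qPoch_zero]
    | succ n ih =>
      rw [← ih, tsum_eulerTerm_eq_mul hq1 hq0 (mul_ne_zero (pow_ne_zero n hq0) hy), qPoch_succ,
        pow_succ']
      simp only [mul_assoc]
      ring
  have h1 := (tendsto_qPoch hq1 (-(q * y))).mul (tendsto_tsum_eulerTerm hq1 hq0 hy)
  simp_rw [h, mul_one] at h1
  exact (tendsto_nhds_unique h1 tendsto_const_nhds)

/-! ### The Durfee rectangle identity -/

/-- The general term of the Durfee rectangle series. -/
noncomputable def durfeeTerm (q : ℂ) (k b : ℤ) : ℂ :=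
  q ^ (b * b + k * b) * qFacInv q b * qFacInv q (b + k)

theorem zpow_sq_add_mul {q : ℂ} (hq0 : q ≠ 0) (k b : ℤ) :
    q ^ (b * b + k * b) = (q ^ 2) ^ tri b * (q ^ (k - 1)) ^ b := by
  rw [← zpow_natCast, ← zpow_mul, ← zpow_mul, ← zpow_add₀ hq0]
  congr 1
  have := two_mul_tri b
  push_cast
  linarith

theorem norm_sq_lt_one {q : ℂ} (hq1 : ‖q‖ < 1) : ‖q ^ 2‖ < 1 := by
  rw [norm_pow]
  exact pow_lt_one₀ (norm_nonneg q) hq1 two_ne_zero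

theorem summable_norm_zpow_sq_add_mul {q : ℂ} (hq1 : ‖q‖ < 1) (hq0 : q ≠ 0) (k : ℤ) :
    Summable (fun b : ℤ => ‖q ^ (b * b + k * b)‖) := by
  simp_rw [zpow_sq_add_mul hq0]
  exact summable_norm_tri_mul (norm_sq_lt_one hq1) (pow_ne_zero 2 hq0) (zpow_ne_zero _ hq0)

theorem exists_norm_durfeeTerm_le {q : ℂ} (hq1 : ‖q‖ < 1) :
    ∃ M : ℝ, 0 ≤ M ∧ ∀ k b, ‖durfeeTerm q k b‖ ≤ ‖q ^ (b * b + k * b)‖ * M := by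
  obtain ⟨M, h0, hM⟩ := exists_norm_qFacInv_le hq1
  refine ⟨M * M, mul_nonneg h0 h0, fun k b => ?_⟩
  rw [durfeeTerm, mul_assoc, norm_mul, norm_mul]
  gcongr
  · exact hM b
  · exact hM (b + k)

theorem summable_norm_durfeeTerm {q : ℂ} (hq1 : ‖q‖ < 1) (hq0 : q ≠ 0) (k : ℤ) :
    Summable (fun b => ‖durfeeTerm q k b‖) := by
  obtain ⟨M, h0, hM⟩ := exists_norm_durfeeTerm_le hq1
  exact Summable.of_nonneg_of_le (fun _ => norm_nonneg _) (hM k)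
    ((summable_norm_zpow_sq_add_mul hq1 hq0 k).mul_right M)

/-- A majorant independent of k, for dominated convergence as k → ∞. Negative b contribute zero, and
for b ≥ 0 the factor q^{kb} has norm at most one. -/
theorem exists_norm_durfeeTerm_le_of_nonneg {q : ℂ} (hq1 : ‖q‖ < 1) :
    ∃ M : ℝ, 0 ≤ M ∧ ∀ k b, 0 ≤ k → ‖durfeeTerm q k b‖ ≤ ‖q ^ (b * b + 0 * b)‖ * M := by
  obtain ⟨M, h0, hM⟩ := exists_norm_durfeeTerm_le hq1
  refine ⟨M, h0, fun k b hk => ?_⟩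
  rcases lt_or_ge b 0 with h | h
  · rw [durfeeTerm, qFacInv_of_neg q h]
    simp only [mul_zero, zero_mul, norm_zero]
    positivity
  · refine (hM k b).trans ?_
    gcongr
    lift b to ℕ using h
    lift k to ℕ using hk
    norm_cast
    rw [norm_pow, norm_pow]
    exact pow_le_pow_of_le_one (norm_nonneg q) hq1.le (by simp)

/-- The q-factorial recurrence applied to both factors gives the relation termwise, up to a shift of
b. It shows that consecutive differences contract as k ≥ 0 decreases. -/
theorem tsum_durfeeTerm_sub {q : ℂ} (hq1 : ‖q‖ < 1) (hq0 : q ≠ 0) (k : ℤ) :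
    ∑' b, durfeeTerm q k b - ∑' b, durfeeTerm q (k + 1) b =
      -q ^ (k + 1) * (∑' b, durfeeTerm q (k + 1) b - ∑' b, durfeeTerm q (k + 1 + 1) b) := by
  have s := fun k => (summable_norm_durfeeTerm hq1 hq0 k).of_norm
  have key : ∀ b, durfeeTerm q k b - durfeeTerm q (k + 1) b =
      q ^ (k + 1) * durfeeTerm q (k + 1 + 1) (b - 1) - q ^ (k + 1) * durfeeTerm q (k + 1) b := by
    intro b
    have h1 := qFacInv_sub_one hq1 b
    have h2 := qFacInv_sub_one hq1 (b + (k + 1))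
    rw [show b + (k + 1) - 1 = b + k by ring] at h2
    simp only [durfeeTerm]
    rw [h1, h2, show b - 1 + (k + 1 + 1) = b + (k + 1) by ring,
      show (b - 1) * (b - 1) + (k + 1 + 1) * (b - 1) = (b * b + k * b) - (k + 1) by ring,
      show b * b + (k + 1) * b = (b * b + k * b) + b by ring,
      zpow_sub₀ hq0 (b * b + k * b), zpow_add₀ hq0 (b * b + k * b), zpow_add₀ hq0 b]
    have := zpow_ne_zero (k + 1) hq0
    field_simp
    ring
  rw [← (s k).tsum_sub (s (k + 1)), tsum_congr key, Summable.tsum_sub, tsum_mul_left, tsum_mul_left]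
  · have := (Equiv.subRight (1 : ℤ)).tsum_eq (durfeeTerm q (k + 1 + 1))
    simp only [Equiv.subRight_apply] at this
    rw [this]
    ring
  · exact (((Equiv.subRight (1 : ℤ)).summable_iff).2 (s (k + 1 + 1))).mul_left _
  · exact (s (k + 1)).mul_left _

theorem tendsto_tsum_durfeeTerm {q : ℂ} (hq1 : ‖q‖ < 1) (hq0 : q ≠ 0) :
    Tendsto (fun k : ℕ => ∑' b, durfeeTerm q k b) atTop (𝓝 (qPochInf q q)⁻¹) := by
  obtain ⟨M, h0, hM⟩ := exists_norm_durfeeTerm_le_of_nonneg hq1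
  have h1 : ∑' b : ℤ, (if b = 0 then (qPochInf q q)⁻¹ else 0) = (qPochInf q q)⁻¹ := by simp
  rw [← h1]
  refine tendsto_tsum_of_dominated_convergence
    ((summable_norm_zpow_sq_add_mul hq1 hq0 0).mul_right M) ?_ ?_
  · intro b
    rcases lt_trichotomy b 0 with h | rfl | h
    · simp [durfeeTerm, qFacInv_of_neg q h, h.ne]
    · simpa [durfeeTerm, qFacInv_zero] using tendsto_qFacInv hq1
    · lift b to ℕ using h.le
      have hb : b ≠ 0 := by omega
      have e : ∀ k : ℕ, durfeeTerm q k b =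
          (q ^ b) ^ k * (q ^ (b * b) * qFacInv q b) * qFacInv q ((k + b : ℕ) : ℤ) := by
        intro k
        rw [durfeeTerm, zpow_add₀ hq0, Nat.cast_add, add_comm (b : ℤ) k]
        norm_cast
        rw [pow_mul' q k b]
        ring
      simp_rw [e]
      have : ‖q ^ b‖ < 1 := by
        rw [norm_pow]
        exact pow_lt_one₀ (norm_nonneg q) hq1 hb
      have h2 := ((tendsto_pow_atTop_nhds_zero_of_norm_lt_one this).mul_const
        (q ^ (b * b) * qFacInv q b)).mul ((tendsto_qFacInv hq1).comp (tendsto_add_atTop_nat b))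
      simpa [h.ne', hb] using h2
  · exact Eventually.of_forall fun k b => hM k b (by positivity)

/-- The Durfee rectangle identity. -/
theorem tsum_durfeeTerm {q : ℂ} (hq1 : ‖q‖ < 1) (hq0 : q ≠ 0) (k : ℤ) :
    ∑' b, durfeeTerm q k b = (qPochInf q q)⁻¹ := by
  set δ : ℤ → ℂ := fun k => ∑' b, durfeeTerm q k b - ∑' b, durfeeTerm q (k + 1) b with hδ
  have hrec : ∀ k, δ k = -q ^ (k + 1) * δ (k + 1) := tsum_durfeeTerm_sub hq1 hq0
  have hlim : Tendsto (fun n : ℕ => ‖δ n‖) atTop (𝓝 0) := by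
    have h := tendsto_tsum_durfeeTerm hq1 hq0
    have h2 := (h.sub (h.comp (tendsto_add_atTop_nat 1))).norm
    simpa [hδ] using h2
  have hnat : ∀ n : ℕ, δ n = 0 := by
    intro n
    -- The norms of δ are nondecreasing on the naturals but tend to zero, so δ vanishes there; the
    -- recurrence then carries the vanishing to negative indices.
    have hmono : ∀ m : ℕ, ‖δ n‖ ≤ ‖δ ((n + m : ℕ) : ℤ)‖ := by
      intro m
      induction m with
      | zero => simp
      | succ m ih =>
        refine ih.trans ?_
        rw [hrec, norm_mul, norm_neg]
        have e : ((n + m : ℕ) : ℤ) + 1 = ((n + (m + 1) : ℕ) : ℤ) := by push_cast; ring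
        rw [e, zpow_natCast, norm_pow]
        exact mul_le_of_le_one_left (norm_nonneg _) (pow_le_one₀ (norm_nonneg q) hq1.le)
    have h3 : Tendsto (fun m : ℕ => ‖δ ((n + m : ℕ) : ℤ)‖) atTop (𝓝 0) := by
      have := hlim.comp (tendsto_add_atTop_nat n)
      refine this.congr fun m => ?_
      simp [add_comm]
    exact norm_le_zero_iff.1 (ge_of_tendsto' h3 hmono)
  have hneg : ∀ n : ℕ, δ (-n) = 0 := by
    intro n
    induction n with
    | zero => simpa using hnat 0
    | succ n ih =>
      rw [hrec, Nat.cast_add, Nat.cast_one, neg_add, neg_add_cancel_right, ih, mul_zero]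
  have hall : ∀ k, δ k = 0 := by
    intro k
    obtain ⟨n, rfl | rfl⟩ := k.eq_nat_or_neg
    · exact hnat n
    · exact hneg n
  have hconst : ∀ m : ℕ, ∑' b, durfeeTerm q (k + m) b = ∑' b, durfeeTerm q k b := by
    intro m
    induction m with
    | zero => simp
    | succ m ih =>
      have := hall (k + m)
      rw [Nat.cast_add, Nat.cast_one, ← add_assoc, ← ih]
      exact (sub_eq_zero.1 this).symm
  have hconst0 : ∀ m : ℕ, ∑' b, durfeeTerm q m b = ∑' b, durfeeTerm q 0 b := by
    intro m
    induction m with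
    | zero => simp
    | succ m ih =>
      have := hall m
      rw [Nat.cast_add, Nat.cast_one, ← ih]
      exact (sub_eq_zero.1 this).symm
  have h0 : ∑' b, durfeeTerm q 0 b = (qPochInf q q)⁻¹ := by
    have := tendsto_tsum_durfeeTerm hq1 hq0
    simp_rw [hconst0] at this
    exact tendsto_nhds_unique tendsto_const_nhds this
  rcases le_or_gt 0 k with h | h
  · lift k to ℕ using h
    rw [hconst0, h0]
  · have := hconst (-k).toNat
    rw [Int.toNat_of_nonneg (by omega), add_neg_cancel, h0] at this
    exact this.symm

/-! ### The Jacobi triple product -/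

/-- The general term of the theta series. -/
noncomputable def thetaTerm (x q : ℂ) (k : ℤ) : ℂ := q ^ tri k * (-(x / q)) ^ k

theorem summable_norm_thetaTerm {q : ℂ} (hq1 : ‖q‖ < 1) (hq0 : q ≠ 0) {x : ℂ} (hx : x ≠ 0) :
    Summable (fun k => ‖thetaTerm x q k‖) :=
  summable_norm_tri_mul hq1 hq0 (neg_ne_zero.2 (div_ne_zero hx hq0))

/-- The equivalence `(k, b) ↦ (b + k, b)` of `ℤ × ℤ`. -/
def shearEquiv : ℤ × ℤ ≃ ℤ × ℤ where
  toFun z := (z.2 + z.1, z.2)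
  invFun z := (z.1 - z.2, z.2)
  left_inv z := by simp
  right_inv z := by simp

/-- The Jacobi triple product identity. -/
theorem theta_eq_tsum {q : ℂ} (hq1 : ‖q‖ < 1) (hq0 : q ≠ 0) {x : ℂ} (hx : x ≠ 0) :
    theta x q = ∑' k, thetaTerm x q k := by
  have hy : -(x / q) ≠ 0 := neg_ne_zero.2 (div_ne_zero hx hq0)
  have hz : -x⁻¹ ≠ 0 := neg_ne_zero.2 (inv_ne_zero hx)
  have e1 := qPochInf_eq_tsum_eulerTerm hq1 hq0 hy
  have e2 := qPochInf_eq_tsum_eulerTerm hq1 hq0 hz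
  rw [show -(q * -(x / q)) = x by field_simp] at e1
  rw [show -(q * -x⁻¹) = q / x by field_simp] at e2
  have s1 := summable_norm_eulerTerm hq1 hq0 hy
  have s2 := summable_norm_eulerTerm hq1 hq0 hz
  have s3 := (shearEquiv.summable_iff).2 (summable_mul_of_summable_norm s1 s2)
  simp only [Function.comp_def] at s3
  have key : ∀ k b, eulerTerm q (-(x / q)) (b + k) * eulerTerm q (-x⁻¹) b =
      thetaTerm x q k * durfeeTerm q k b := by
    intro k b
    simp only [eulerTerm, thetaTerm, durfeeTerm]
    have h1 : q ^ (b * b + k * b) = q ^ tri b * q ^ tri b * q ^ (b * k) * (q ^ b)⁻¹ := by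
      rw [← zpow_add₀ hq0, ← zpow_add₀ hq0, ← zpow_neg, ← zpow_add₀ hq0]
      congr 1
      linarith [two_mul_tri b]
    have h2 : (-(x / q)) ^ b * (-x⁻¹) ^ b = (q ^ b)⁻¹ := by
      rw [← mul_zpow, ← inv_zpow]
      congr 1
      field_simp
    rw [tri_add, zpow_add₀ hq0, zpow_add₀ hq0, zpow_add₀ hy, h1, ← h2]
    ring
  -- After the shear, the sum over b at fixed k is a Durfee rectangle sum. It does not depend on k
  -- and cancels the factor (q; q)_∞.
  rw [theta, e1, e2, tsum_mul_tsum_of_summable_norm s1 s2, ← shearEquiv.tsum_eq]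
  rw [Summable.tsum_prod s3]
  simp only [shearEquiv, Equiv.coe_fn_mk, key, tsum_mul_left, tsum_durfeeTerm hq1 hq0]
  rw [tsum_mul_right, inv_mul_cancel_right₀ (qPochInf_self_ne_zero hq1)]

/-! ### Splitting products by residue classes, and pentagonal series -/

theorem qPoch_two_mul (x q : ℂ) (n : ℕ) :
    qPoch x q (2 * n) = qPoch x (q ^ 2) n * qPoch (q * x) (q ^ 2) n := by
  induction n with
  | zero => simp [qPoch_zero]
  | succ n ih =>
    rw [show 2 * (n + 1) = 2 * n + 1 + 1 by ring, qPoch_succ, qPoch_succ, ih, qPoch_succ, qPoch_succ]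
    ring

theorem qPoch_three_mul (x q : ℂ) (n : ℕ) :
    qPoch x q (3 * n) =
      qPoch x (q ^ 3) n * qPoch (q * x) (q ^ 3) n * qPoch (q ^ 2 * x) (q ^ 3) n := by
  induction n with
  | zero => simp [qPoch_zero]
  | succ n ih =>
    rw [show 3 * (n + 1) = 3 * n + 1 + 1 + 1 by ring, qPoch_succ, qPoch_succ, qPoch_succ, ih,
      qPoch_succ, qPoch_succ, qPoch_succ]
    ring

theorem qPoch_mul_qPoch_neg (x q : ℂ) (n : ℕ) :
    qPoch x q n * qPoch (-x) q n = qPoch (x ^ 2) (q ^ 2) n := by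
  rw [qPoch, qPoch, qPoch, ← Finset.prod_mul_distrib]
  exact Finset.prod_congr rfl fun i _ => by ring

theorem norm_pow_lt_one {q : ℂ} (hq1 : ‖q‖ < 1) {n : ℕ} (hn : n ≠ 0) : ‖q ^ n‖ < 1 := by
  rw [norm_pow]
  exact pow_lt_one₀ (norm_nonneg q) hq1 hn

theorem qPochInf_eq_mul_sq {q : ℂ} (hq1 : ‖q‖ < 1) (x : ℂ) :
    qPochInf x q = qPochInf x (q ^ 2) * qPochInf (q * x) (q ^ 2) := by
  have h2 := norm_pow_lt_one hq1 two_ne_zero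
  refine tendsto_nhds_unique
    ((tendsto_qPoch hq1 x).comp (tendsto_id.const_mul_atTop' (r := 2) two_pos)) ?_
  refine ((tendsto_qPoch h2 x).mul (tendsto_qPoch h2 (q * x))).congr fun n => ?_
  simp [qPoch_two_mul]

theorem qPochInf_eq_mul_cube {q : ℂ} (hq1 : ‖q‖ < 1) (x : ℂ) :
    qPochInf x q =
      qPochInf x (q ^ 3) * qPochInf (q * x) (q ^ 3) * qPochInf (q ^ 2 * x) (q ^ 3) := by
  have h2 := norm_pow_lt_one hq1 three_ne_zero
  refine tendsto_nhds_unique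
    ((tendsto_qPoch hq1 x).comp (tendsto_id.const_mul_atTop' (r := 3) three_pos)) ?_
  refine (((tendsto_qPoch h2 x).mul (tendsto_qPoch h2 (q * x))).mul
    (tendsto_qPoch h2 (q ^ 2 * x))).congr fun n => ?_
  simp [qPoch_three_mul]

theorem qPochInf_mul_neg {q : ℂ} (hq1 : ‖q‖ < 1) (x : ℂ) :
    qPochInf x q * qPochInf (-x) q = qPochInf (x ^ 2) (q ^ 2) := by
  have h2 := norm_pow_lt_one hq1 two_ne_zero
  refine tendsto_nhds_unique ((tendsto_qPoch hq1 x).mul (tendsto_qPoch hq1 (-x))) ?_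
  refine (tendsto_qPoch h2 (x ^ 2)).congr fun n => ?_
  simp [qPoch_mul_qPoch_neg]

theorem theta_self_cube {q : ℂ} (hq1 : ‖q‖ < 1) (hq0 : q ≠ 0) :
    theta q (q ^ 3) = qPochInf q q := by
  rw [qPochInf_eq_mul_cube hq1 q, theta, show q ^ 3 / q = q * q by field_simp,
    show q ^ 2 * q = q ^ 3 by ring]

theorem theta_sq_cube {q : ℂ} (hq1 : ‖q‖ < 1) (hq0 : q ≠ 0) :
    theta (q ^ 2) (q ^ 3) = qPochInf q q := by
  rw [qPochInf_eq_mul_cube hq1 q, theta, show q ^ 3 / q ^ 2 = q by field_simp,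
    show q ^ 2 * q = q ^ 3 by ring, show q * q = q ^ 2 by ring]
  ring

theorem neg_one_zpow_mul_self (n : ℤ) : ((-1 : ℂ) ^ n) * (-1) ^ n = 1 := by
  rw [← mul_zpow]; simp

theorem thetaTerm_cube {q : ℂ} (hq0 : q ≠ 0) (j : ℕ) (n : ℤ) :
    thetaTerm (q ^ j) (q ^ 3) n = (-1) ^ n * q ^ (3 * tri n + (j - 3) * n) := by
  have h : -(q ^ j / q ^ 3) = -1 * q ^ ((j : ℤ) - 3) := by
    rw [zpow_sub₀ hq0, zpow_natCast, show q ^ (3 : ℤ) = q ^ 3 from zpow_natCast q 3]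
    ring
  rw [thetaTerm, h, mul_zpow, ← zpow_mul, zpow_add₀ hq0, ← zpow_natCast, ← zpow_mul]
  push_cast
  ring

theorem summable_pentagonal {q : ℂ} (hq1 : ‖q‖ < 1) (hq0 : q ≠ 0) (j : ℕ) :
    Summable (fun n : ℤ => (-1) ^ n * q ^ (3 * tri n + (j - 3) * n)) := by
  refine (summable_norm_thetaTerm (norm_pow_lt_one hq1 three_ne_zero) (pow_ne_zero 3 hq0)
    (pow_ne_zero j hq0)).of_norm.congr fun n => ?_
  rw [thetaTerm_cube hq0]

/-- Only j = 0, 1, 2, 3 are used: the value is (q; q)_∞ for j = 1, 2 (the pentagonal number theorem)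
and zero for j = 0, 3. -/
theorem tsum_pentagonal {q : ℂ} (hq1 : ‖q‖ < 1) (hq0 : q ≠ 0) (j : ℕ) :
    ∑' n : ℤ, (-1) ^ n * q ^ (3 * tri n + (j - 3) * n) = theta (q ^ j) (q ^ 3) := by
  rw [theta_eq_tsum (norm_pow_lt_one hq1 three_ne_zero) (pow_ne_zero 3 hq0) (pow_ne_zero j hq0)]
  simp_rw [thetaTerm_cube hq0]

theorem theta_one {q : ℂ} (hq1 : ‖q‖ < 1) : theta 1 q = 0 := by
  rw [theta, qPochInf_eq_mul hq1 1]
  simp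

/-! ### Keeping x qⁿ away from 1 -/

/-- `x` is not an integral power of `q`. -/
def NotPower (x q : ℂ) : Prop := ∀ n : ℤ, x * q ^ n ≠ 1

/-- |x qⁿ| tends to 0 or ∞ as n → ±∞, uniformly for x in an annulus around a. The uniformity makes
tails of Appell–Lerch series holomorphic and isolates their poles. -/
theorem exists_finset_half_le_norm {q : ℂ} (hq1 : ‖q‖ < 1) (hq0 : q ≠ 0) {a : ℂ} (ha : a ≠ 0) :
    ∃ N : Finset ℤ, ∀ n ∉ N, ∀ x : ℂ, ‖a‖ / 2 ≤ ‖x‖ → ‖x‖ ≤ 2 * ‖a‖ → 1 / 2 ≤ ‖1 - x * q ^ n‖ := by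
  have ha' := norm_pos_iff.2 ha
  have hq' := norm_pos_iff.2 hq0
  have ht := tendsto_pow_atTop_nhds_zero_of_lt_one (norm_nonneg q) hq1
  -- The thresholds force |x qⁿ| ≤ 1/2 for n > A and |x qⁿ| ≥ 3/2 for n < -B throughout the annulus.
  obtain ⟨A, hA⟩ := eventually_atTop.1 (ht.eventually_lt_const
    (show 0 < 1 / (4 * ‖a‖) by positivity))
  obtain ⟨B, hB⟩ := eventually_atTop.1 (ht.eventually_lt_const
    (show 0 < ‖a‖ / 3 by positivity))
  refine ⟨Finset.Icc (-(B : ℤ)) A, fun n hn x h1 h2 => ?_⟩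
  rw [Finset.mem_Icc, not_and_or, not_le, not_le] at hn
  rcases hn with hn | hn
  · obtain ⟨m, rfl⟩ : ∃ m : ℕ, n = -m := ⟨(-n).toNat, by omega⟩
    have hm := hB m (by omega)
    have h3 : 3 / 2 ≤ ‖x * q ^ (-(m : ℤ))‖ := by
      rw [norm_mul, zpow_neg, norm_inv, zpow_natCast, norm_pow, ← div_eq_mul_inv,
        le_div_iff₀ (by positivity)]
      linarith
    have h4 := norm_sub_norm_le (x * q ^ (-(m : ℤ))) 1
    rw [norm_sub_rev, norm_one] at h4
    linarith
  · obtain ⟨m, rfl⟩ : ∃ m : ℕ, n = m := ⟨n.toNat, by omega⟩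
    have hm := hA m (by omega)
    have h3 : ‖x * q ^ (m : ℤ)‖ ≤ 1 / 2 := by
      rw [norm_mul, zpow_natCast, norm_pow]
      rw [lt_div_iff₀ (by positivity)] at hm
      have : ‖x‖ * ‖q‖ ^ m ≤ (2 * ‖a‖) * ‖q‖ ^ m := by gcongr
      linarith
    have h4 := norm_sub_norm_le 1 (x * q ^ (m : ℤ))
    rw [norm_one] at h4
    linarith

theorem exists_norm_inv_le {q : ℂ} (hq1 : ‖q‖ < 1) (hq0 : q ≠ 0) {x : ℂ} (hx : x ≠ 0) :
    ∃ M : ℝ, 0 ≤ M ∧ ∀ n : ℤ, ‖(1 - x * q ^ n)⁻¹‖ ≤ M := by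
  obtain ⟨N, hN⟩ := exists_finset_half_le_norm hq1 hq0 hx
  refine ⟨2 + ∑ n ∈ N, ‖(1 - x * q ^ n)⁻¹‖, by positivity, fun n => ?_⟩
  by_cases hn : n ∈ N
  · have := Finset.single_le_sum (f := fun n => ‖(1 - x * q ^ n)⁻¹‖) (fun _ _ => norm_nonneg _) hn
    linarith
  · have h := hN n hn x (by linarith [norm_nonneg x]) (by linarith [norm_nonneg x])
    have h1 : 0 ≤ ∑ n ∈ N, ‖(1 - x * q ^ n)⁻¹‖ := by positivity
    have h2 : ‖(1 - x * q ^ n)⁻¹‖ ≤ 2 := by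
      rw [norm_inv]
      exact (inv_anti₀ (by norm_num) h).trans (by norm_num)
    linarith

/-! ### Partial fractions for the terms of g -/

theorem summable_mul_qFacInv (q : ℂ) (m n : ℤ) (c : ℤ → ℂ) :
    Summable (fun k => c k * (qFacInv q (m - k) * qFacInv q (n + k))) := by
  refine summable_of_hasFiniteSupport ((Set.finite_Icc (-n) m).subset fun k hk => ?_)
  rw [Set.mem_Icc]
  by_contra h
  apply hk
  rw [not_and_or, not_le, not_le] at h
  rcases h with h | h
  · simp [qFacInv_of_neg q (show n + k < 0 by omega)]
  · simp [qFacInv_of_neg q (show m - k < 0 by omega)]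

/-- The reflection k ↦ 1 - k changes the sign of every term. -/
theorem tsum_alternating_odd (q : ℂ) (N : ℤ) :
    ∑' k : ℤ, (-1) ^ k * q ^ (tri k - k) * (qFacInv q (N - k) * qFacInv q (N - 1 + k)) = 0 := by
  have h := (Equiv.subLeft (1 : ℤ)).tsum_eq
    (fun k : ℤ => (-1) ^ k * q ^ (tri k - k) * (qFacInv q (N - k) * qFacInv q (N - 1 + k)))
  have key : ∀ k : ℤ, (-1) ^ (1 - k) * q ^ (tri (1 - k) - (1 - k)) *
      (qFacInv q (N - (1 - k)) * qFacInv q (N - 1 + (1 - k))) =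
      -((-1) ^ k * q ^ (tri k - k) * (qFacInv q (N - k) * qFacInv q (N - 1 + k))) := by
    intro k
    have e : tri (1 - k) - (1 - k) = tri k - k := by
      rw [sub_eq_add_neg 1 k, tri_add, tri_one, tri_neg]
      ring
    have e2 : (-1 : ℂ) ^ (1 - k) = -(-1) ^ k := by
      rw [zpow_sub₀ (by norm_num), zpow_one, div_eq_iff (zpow_ne_zero _ (by norm_num)), neg_mul,
        neg_one_zpow_mul_self]
    rw [e, e2, show N - (1 - k) = N - 1 + k by ring, show N - 1 + (1 - k) = N - k by ring]
    ring
  simp only [Equiv.subLeft_apply, key, tsum_neg] at h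
  linear_combination (-1 / 2 : ℂ) * h

/-- Multiplied by 1 - q^{2N}, the summand is a combination of w(k) and w(k + 1), where w is the
summand of `tsum_alternating_odd`. Since N ≠ 0, the factor can be cancelled. -/
theorem tsum_alternating {q : ℂ} (hq1 : ‖q‖ < 1) (hq0 : q ≠ 0) {N : ℕ} (hN : N ≠ 0) :
    ∑' k : ℤ, (-1) ^ k * q ^ tri k * (qFacInv q (N - k) * qFacInv q (N + k)) = 0 := by
  set w : ℤ → ℂ := fun k => (-1) ^ k * q ^ (tri k - k) * (qFacInv q (N - k) * qFacInv q (N - 1 + k))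
    with hw
  have hws : Summable w := summable_mul_qFacInv q N (N - 1) fun k => (-1) ^ k * q ^ (tri k - k)
  have hw0 : ∑' k, w k = 0 := tsum_alternating_odd q N
  have hws1 : Summable fun k => w (k + 1) := (Equiv.addRight (1 : ℤ)).summable_iff.2 hws
  have hw1 : ∑' k, w (k + 1) = 0 := ((Equiv.addRight (1 : ℤ)).tsum_eq w).trans hw0
  have key : ∀ k : ℤ, (1 - q ^ (2 * N)) *
      ((-1) ^ k * q ^ tri k * (qFacInv q (N - k) * qFacInv q (N + k))) =
      q ^ N * w k - w (k + 1) := by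
    intro k
    have h1 := qFacInv_sub_one hq1 (N - k)
    have h2 := qFacInv_sub_one hq1 (N + k)
    have e : tri (k + 1) - (k + 1) = tri k := by rw [tri_add, tri_one]; ring
    simp only [hw]
    rw [e, show (N : ℤ) - (k + 1) = N - k - 1 by ring, show (N : ℤ) - 1 + (k + 1) = N + k by ring,
      show (N : ℤ) - 1 + k = N + k - 1 by ring, h1, h2, zpow_add₀ (by norm_num : (-1 : ℂ) ≠ 0),
      zpow_sub₀ hq0, zpow_sub₀ hq0, zpow_add₀ hq0, zpow_one, zpow_natCast, pow_mul']
    have := zpow_ne_zero k hq0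
    field_simp
    ring
  have h := tsum_congr (L := .unconditional ℤ) key
  rw [tsum_mul_left, (hws.mul_left _).tsum_sub hws1,
    tsum_mul_left, hw0, hw1, mul_zero, sub_zero] at h
  refine (mul_eq_zero.1 h).resolve_left (sub_ne_zero.2 fun h1 => ?_)
  have := norm_pow_lt_one hq1 (n := 2 * N) (by omega)
  rw [← h1, norm_one] at this
  exact lt_irrefl _ this

theorem tsum_alternating' {q : ℂ} (hq1 : ‖q‖ < 1) (hq0 : q ≠ 0) {N : ℕ} (hN : N ≠ 0) :
    ∑' k : ℤ, (-1) ^ k * q ^ (tri k - k) * (qFacInv q (N - k) * qFacInv q (N + k)) = 0 := by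
  rw [← tsum_alternating hq1 hq0 hN, ← (Equiv.neg ℤ).tsum_eq]
  refine tsum_congr fun k => ?_
  simp only [Equiv.neg_apply, tri_neg]
  rw [sub_sub, add_neg_cancel, sub_zero, sub_neg_eq_add, ← sub_eq_add_neg, zpow_neg,
    ← inv_zpow, inv_neg_one]
  ring

/-- The general term of the partial fraction expansion of `1 / ((x; q)_{n+1} (q/x; q)_n)`. -/
noncomputable def pfTerm (x q : ℂ) (n k : ℤ) : ℂ :=
  (-1) ^ k * q ^ tri k * (1 - x * q ^ k)⁻¹ * (qFacInv q (n - k) * qFacInv q (n + k))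

/-- With Q = q^{n+1}, the difference (1 - Qx)(1 - Q/x) - (1 - Qq^{-k})(1 - Qq^k) equals Q(1 -
xq^k)(q^{-k} - x⁻¹). The denominator cancels in the error term, leaving two alternating sums that
vanish. -/
theorem tsum_pfTerm_succ {q : ℂ} (hq1 : ‖q‖ < 1) (hq0 : q ≠ 0) {x : ℂ} (hx : x ≠ 0)
    (h : NotPower x q) (n : ℕ) :
    (∑' k, pfTerm x q (n + 1 : ℕ) k) * ((1 - q ^ (n + 1) * x) * (1 - q ^ n * (q / x))) =
      ∑' k, pfTerm x q n k := by
  have key : ∀ k : ℤ, pfTerm x q (n + 1 : ℕ) k * ((1 - q ^ (n + 1) * x) * (1 - q ^ n * (q / x))) =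
      pfTerm x q n k + (q ^ (n + 1) * ((-1) ^ k * q ^ (tri k - k) *
        (qFacInv q ((n + 1 : ℕ) - k) * qFacInv q ((n + 1 : ℕ) + k))) - q ^ (n + 1) / x *
        ((-1) ^ k * q ^ tri k * (qFacInv q ((n + 1 : ℕ) - k) * qFacInv q ((n + 1 : ℕ) + k)))) := by
    intro k
    have h1 := qFacInv_sub_one hq1 ((n + 1 : ℕ) - k)
    have h2 := qFacInv_sub_one hq1 ((n + 1 : ℕ) + k)
    have hk : 1 - x * q ^ k ≠ 0 := sub_ne_zero.2 (h k).symm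
    have hqk := zpow_ne_zero k hq0
    simp only [pfTerm]
    rw [show (n : ℤ) - k = (n + 1 : ℕ) - k - 1 by push_cast; ring,
      show (n : ℤ) + k = (n + 1 : ℕ) + k - 1 by push_cast; ring, h1, h2, zpow_sub₀ hq0,
      zpow_sub₀ hq0, zpow_add₀ hq0, zpow_natCast, pow_succ]
    generalize qFacInv q ((n + 1 : ℕ) - k) = r1
    generalize qFacInv q ((n + 1 : ℕ) + k) = r2
    generalize q ^ k = y at *
    generalize q ^ n = z at *
    field_simp
    ring
  have hN : n + 1 ≠ 0 := Nat.succ_ne_zero n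
  rw [← tsum_mul_right, tsum_congr key, Summable.tsum_add, Summable.tsum_sub, tsum_mul_left,
    tsum_mul_left, tsum_alternating hq1 hq0 hN, tsum_alternating' hq1 hq0 hN]
  · simp
  · exact (summable_mul_qFacInv q _ _ _).mul_left _
  · exact (summable_mul_qFacInv q _ _ _).mul_left _
  · exact summable_mul_qFacInv q _ _ _
  · exact ((summable_mul_qFacInv q _ _ _).mul_left _).sub
      ((summable_mul_qFacInv q _ _ _).mul_left _)

theorem gDenom_succ (x q : ℂ) (n : ℕ) :
    gDenom x q (n + 1) = gDenom x q n * ((1 - q ^ (n + 1) * x) * (1 - q ^ n * (q / x))) := by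
  rw [gDenom, qPoch_succ, qPoch_succ (q / x), gDenom]
  ring

theorem gDenom_mul_tsum_pfTerm {q : ℂ} (hq1 : ‖q‖ < 1) (hq0 : q ≠ 0) {x : ℂ} (hx : x ≠ 0)
    (h : NotPower x q) (n : ℕ) : gDenom x q n * ∑' k, pfTerm x q n k = 1 := by
  induction n with
  | zero =>
    rw [tsum_eq_single 0]
    · have := sub_ne_zero.2 (h 0).symm
      simp only [zpow_zero, mul_one] at this
      simp [pfTerm, tri_zero, qFacInv_zero, gDenom, qPoch, this]
    · intro k hk
      rcases lt_or_gt_of_ne hk with h1 | h1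
      · simp [pfTerm, qFacInv_of_neg q h1]
      · simp [pfTerm, qFacInv_of_neg q (show -k < 0 by omega)]
  | succ n ih =>
    rw [gDenom_succ, mul_assoc, mul_comm (_ * _) (∑' k, _), tsum_pfTerm_succ hq1 hq0 hx h, ih]

theorem gDenom_ne_zero {q : ℂ} (hq1 : ‖q‖ < 1) (hq0 : q ≠ 0) {x : ℂ} (hx : x ≠ 0)
    (h : NotPower x q) (n : ℕ) : gDenom x q n ≠ 0 :=
  left_ne_zero_of_mul_eq_one (gDenom_mul_tsum_pfTerm hq1 hq0 hx h n)

/-- Allows the outer index n to run over ℤ, so that the substitution n = b + k is a bijection. -/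
theorem tsum_pfTerm_of_neg (x q : ℂ) {n : ℤ} (hn : n < 0) : ∑' k, pfTerm x q n k = 0 := by
  rw [← tsum_zero (β := ℤ)]
  refine tsum_congr fun k => ?_
  rcases le_or_gt 0 k with h | h
  · simp [pfTerm, qFacInv_of_neg q (show n - k < 0 by omega)]
  · simp [pfTerm, qFacInv_of_neg q (show n + k < 0 by omega)]

/-- The remaining factors are bounded, so the product of the series of |q^{n²}| and |q^{k(k+1)/2}|
is a majorant; this justifies interchanging the sums. -/
theorem summable_sq_mul_pfTerm {q : ℂ} (hq1 : ‖q‖ < 1) (hq0 : q ≠ 0) {x : ℂ} (hx : x ≠ 0) :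
    Summable (fun z : ℤ × ℤ => q ^ (z.1 * z.1) * pfTerm x q z.1 z.2) := by
  obtain ⟨M, hM0, hM⟩ := exists_norm_qFacInv_le hq1
  obtain ⟨K, hK0, hK⟩ := exists_norm_inv_le hq1 hq0 hx
  have s1 := summable_norm_zpow_sq_add_mul hq1 hq0 0
  have s2 := (summable_norm_tri_mul hq1 hq0 one_ne_zero).mul_right (K * (M * M))
  have s := s1.mul_of_nonneg s2 (fun _ => norm_nonneg _) (fun _ => by positivity)
  refine Summable.of_norm_bounded s fun z => ?_
  simp only [pfTerm, norm_mul, zero_mul, add_zero, one_zpow, mul_one, norm_zpow, norm_neg, norm_one,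
    one_mul]
  rw [mul_assoc]
  gcongr
  · exact hK z.2
  · exact hM _
  · exact hM _

theorem hasSum_sq_div_gDenom {q : ℂ} (hq1 : ‖q‖ < 1) (hq0 : q ≠ 0) {x : ℂ} (hx : x ≠ 0)
    (h : NotPower x q) :
    HasSum (fun n : ℕ => q ^ (n ^ 2) / gDenom x q n)
      (∑' k : ℤ, (-1) ^ k * q ^ (3 * tri k - k) * (1 - x * q ^ k)⁻¹ * (qPochInf q q)⁻¹) := by
  have s := summable_sq_mul_pfTerm hq1 hq0 hx
  have e : ∀ n : ℕ, q ^ (n ^ 2) / gDenom x q n = ∑' k, q ^ ((n : ℤ) * n) * pfTerm x q n k := by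
    intro n
    rw [tsum_mul_left, div_eq_mul_inv,
      inv_eq_of_mul_eq_one_right (gDenom_mul_tsum_pfTerm hq1 hq0 hx h n), sq]
    norm_cast
  simp_rw [e]
  obtain ⟨F, hF⟩ : ∃ F : ℤ → ℂ, F = fun n => ∑' k, q ^ (n * n) * pfTerm x q n k := ⟨_, rfl⟩
  have hsupp : Function.support F ⊆ Set.range (Nat.cast : ℕ → ℤ) := by
    intro n hn
    by_contra h'
    refine hn ?_
    have : n < 0 := by
      by_contra h2
      exact h' ⟨n.toNat, by omega⟩
    simp only [hF, tsum_mul_left, tsum_pfTerm_of_neg x q this, mul_zero]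
  have hsF : Summable F := hF ▸ s.prod
  have hval : ∑' n, F n =
      ∑' k : ℤ, (-1) ^ k * q ^ (3 * tri k - k) * (1 - x * q ^ k)⁻¹ * (qPochInf q q)⁻¹ := by
    simp only [hF]
    have s' : Summable (Function.uncurry fun n k : ℤ => q ^ (n * n) * pfTerm x q n k) := s
    rw [← s'.tsum_comm]
    refine tsum_congr fun k => ?_
    have key : ∀ n : ℤ, q ^ (n * n) * pfTerm x q n k =
        (-1) ^ k * q ^ (3 * tri k - k) * (1 - x * q ^ k)⁻¹ * durfeeTerm q (2 * k) (n - k) := by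
      intro n
      have e2 : q ^ (n * n) * q ^ tri k =
          q ^ (3 * tri k - k) * q ^ ((n - k) * (n - k) + 2 * k * (n - k)) := by
        rw [← zpow_add₀ hq0, ← zpow_add₀ hq0]
        congr 1
        linarith [two_mul_tri k]
      simp only [pfTerm, durfeeTerm]
      rw [show n - k + 2 * k = n + k by ring]
      linear_combination ((-1) ^ k * (1 - x * q ^ k)⁻¹ * (qFacInv q (n - k) * qFacInv q (n + k))) * e2
    -- With b = n - k the inner sum is the Durfee sum for rectangles of offset 2k.
    rw [tsum_congr key, tsum_mul_left, ← tsum_durfeeTerm hq1 hq0 (2 * k)]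
    congr 1
    exact (Equiv.subRight k).tsum_eq (durfeeTerm q (2 * k))
  have hFn : (fun n : ℕ => ∑' k, q ^ ((n : ℤ) * n) * pfTerm x q n k) = F ∘ (Nat.cast : ℕ → ℤ) := by
    rw [hF]
    rfl
  rw [← hval, hFn]
  exact (Function.Injective.hasSum_iff Nat.cast_injective
    (fun n hn => Function.notMem_support.1 fun h' => hn (hsupp h'))).2 hsF.hasSum

/-! ### The Appell–Lerch series: relation to g and functional equations -/

/-- The general term of the Appell–Lerch type series of the universal mock theta function. -/
noncomputable def appellTerm (x q : ℂ) (n : ℤ) : ℂ :=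
  (-1) ^ n * q ^ (3 * tri n) * (1 - x * q ^ n)⁻¹

/-- The Appell–Lerch type series `∑ (-1)^n q^{3n(n+1)/2} / (1 - x q^n)`. -/
noncomputable def appell (x q : ℂ) : ℂ := ∑' n, appellTerm x q n

theorem summable_norm_zpow_three_mul_tri {q : ℂ} (hq1 : ‖q‖ < 1) (hq0 : q ≠ 0) :
    Summable (fun n : ℤ => ‖q ^ (3 * tri n)‖) := by
  refine (summable_norm_tri_mul (norm_pow_lt_one hq1 three_ne_zero) (pow_ne_zero 3 hq0)
    one_ne_zero).congr fun n => ?_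
  rw [one_zpow, mul_one, zpow_mul]
  norm_cast

theorem summable_appellTerm {q : ℂ} (hq1 : ‖q‖ < 1) (hq0 : q ≠ 0) {x : ℂ} (hx : x ≠ 0) :
    Summable (appellTerm x q) := by
  obtain ⟨K, hK0, hK⟩ := exists_norm_inv_le hq1 hq0 hx
  refine Summable.of_norm_bounded ((summable_norm_zpow_three_mul_tri hq1 hq0).mul_right K)
    fun n => ?_
  simp only [appellTerm, norm_mul, norm_zpow, norm_neg, norm_one, one_zpow, one_mul]
  gcongr
  exact hK n

theorem gDefined_of_notPower {q : ℂ} (hq1 : ‖q‖ < 1) (hq0 : q ≠ 0) {x : ℂ} (hx : x ≠ 0)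
    (h : NotPower x q) : GDefined x q :=
  ⟨hx, gDenom_ne_zero hq1 hq0 hx h, (hasSum_sq_div_gDenom hq1 hq0 hx h).summable⟩

/-- Since q^{-k} / (1 - xq^k) = x / (1 - xq^k) + q^{-k}, the series splits into x times `appell` and
a pentagonal series; the latter cancels the -1 in g. -/
theorem g_eq_appell {q : ℂ} (hq1 : ‖q‖ < 1) (hq0 : q ≠ 0) {x : ℂ} (hx : x ≠ 0)
    (h : NotPower x q) : g x q = appell x q * (qPochInf q q)⁻¹ := by
  have hJ := qPochInf_self_ne_zero hq1
  have s1 := summable_pentagonal hq1 hq0 2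
  have s2 := (summable_appellTerm hq1 hq0 hx).mul_left x
  have h1 := tsum_pentagonal hq1 hq0 2
  rw [theta_sq_cube hq1 hq0] at h1
  have key : ∀ k : ℤ, (-1) ^ k * q ^ (3 * tri k - k) * (1 - x * q ^ k)⁻¹ =
      x * appellTerm x q k + (-1) ^ k * q ^ (3 * tri k + ((2 : ℕ) - 3) * k) := by
    intro k
    have hk : 1 - x * q ^ k ≠ 0 := sub_ne_zero.2 (h k).symm
    have hqk := zpow_ne_zero k hq0
    rw [show 3 * tri k + (((2 : ℕ) : ℤ) - 3) * k = 3 * tri k - k by push_cast; ring, appellTerm,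
      zpow_sub₀ hq0]
    have hi := inv_mul_cancel₀ hk
    generalize (1 - x * q ^ k)⁻¹ = i at *
    field_simp
    linear_combination hi
  rw [g, (hasSum_sq_div_gDenom hq1 hq0 hx h).tsum_eq, tsum_mul_right, tsum_congr key,
    s2.tsum_add s1, h1, tsum_mul_left, ← appell]
  field_simp
  ring

/-- Shifting n by one brings in the factor q^{-3n}. Division with remainder by 1 - xqⁿ leaves -x³
times the original term and three pentagonal series, of which j = 0 vanishes. -/
theorem appell_q_mul {q : ℂ} (hq1 : ‖q‖ < 1) (hq0 : q ≠ 0) {x : ℂ} (hx : x ≠ 0)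
    (h : NotPower x q) :
    appell (q * x) q = -x ^ 3 * appell x q - (x + x ^ 2) * qPochInf q q := by
  have s := summable_pentagonal hq1 hq0
  have h0 := tsum_pentagonal hq1 hq0 0
  have h1 := tsum_pentagonal hq1 hq0 1
  have h2 := tsum_pentagonal hq1 hq0 2
  rw [pow_zero, theta_one (norm_pow_lt_one hq1 three_ne_zero)] at h0
  rw [pow_one, theta_self_cube hq1 hq0] at h1
  rw [theta_sq_cube hq1 hq0] at h2
  have key : ∀ n : ℤ, appellTerm (q * x) q (n - 1) = -x ^ 3 * appellTerm x q n -
      ((-1) ^ n * q ^ (3 * tri n + ((0 : ℕ) - 3) * n) +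
        x * ((-1) ^ n * q ^ (3 * tri n + ((1 : ℕ) - 3) * n)) +
        x ^ 2 * ((-1) ^ n * q ^ (3 * tri n + ((2 : ℕ) - 3) * n))) := by
    intro n
    have hk : 1 - x * q ^ n ≠ 0 := sub_ne_zero.2 (h n).symm
    have hqk := zpow_ne_zero n hq0
    have e1 : q * x * q ^ (n - 1) = x * q ^ n := by
      rw [zpow_sub₀ hq0, zpow_one]
      field_simp
    have e2 : tri (n - 1) = tri n - n := by
      have := two_mul_tri (n - 1)
      have := two_mul_tri n
      linarith
    have e3 : q ^ (3 * (tri n - n)) = q ^ (3 * tri n) / (q ^ n) ^ 3 := by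
      rw [mul_sub, zpow_sub₀ hq0, mul_comm 3 n, zpow_mul q n]
      norm_cast
    have e4 : q ^ (3 * tri n + ((0 : ℕ) - 3) * n) = q ^ (3 * tri n) / (q ^ n) ^ 3 := by
      rw [← e3]
      congr 1
      push_cast
      ring
    have e5 : q ^ (3 * tri n + ((1 : ℕ) - 3) * n) = q ^ (3 * tri n) / (q ^ n) ^ 2 := by
      rw [show 3 * tri n + (((1 : ℕ) : ℤ) - 3) * n = 3 * tri n - n * 2 by push_cast; ring,
        zpow_sub₀ hq0, zpow_mul q n]
      norm_cast
    have e6 : q ^ (3 * tri n + ((2 : ℕ) - 3) * n) = q ^ (3 * tri n) / q ^ n := by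
      rw [show 3 * tri n + (((2 : ℕ) : ℤ) - 3) * n = 3 * tri n - n by push_cast; ring,
        zpow_sub₀ hq0]
    rw [appellTerm, appellTerm, e1, e2, e3, e4, e5, e6, zpow_sub₀ (by norm_num : (-1 : ℂ) ≠ 0),
      zpow_one]
    have hi := inv_mul_cancel₀ hk
    generalize (1 - x * q ^ n)⁻¹ = i at *
    field_simp
    linear_combination (-(1 + x * q ^ n + x ^ 2 * (q ^ n) ^ 2)) * hi
  have hs := (Equiv.subRight (1 : ℤ)).tsum_eq (appellTerm (q * x) q)
  simp only [Equiv.subRight_apply] at hs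
  rw [appell, ← hs, tsum_congr key, Summable.tsum_sub, Summable.tsum_add, Summable.tsum_add,
    tsum_mul_left, tsum_mul_left, tsum_mul_left, h0, h1, h2, ← appell]
  · ring
  · exact s 0
  · exact (s 1).mul_left _
  · exact (s 0).add ((s 1).mul_left _)
  · exact (s 2).mul_left _
  · exact (summable_appellTerm hq1 hq0 hx).mul_left _
  · exact ((s 0).add ((s 1).mul_left _)).add ((s 2).mul_left _)

/-- The reflection n ↦ -1 - n matches the terms up to the pentagonal series j = 3, which is zero. -/
theorem appell_div {q : ℂ} (hq1 : ‖q‖ < 1) (hq0 : q ≠ 0) {x : ℂ} (hx : x ≠ 0)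
    (h : NotPower x q) : appell (q / x) q = appell x q := by
  have s := summable_pentagonal hq1 hq0 3
  have h0 := tsum_pentagonal hq1 hq0 3
  have hz : theta (q ^ 3) (q ^ 3) = 0 := by
    have h3 := norm_pow_lt_one hq1 three_ne_zero
    rw [theta, div_self (pow_ne_zero 3 hq0), qPochInf_eq_mul h3 1]
    simp
  rw [hz] at h0
  have key : ∀ n : ℤ, appellTerm (q / x) q (-1 - n) =
      appellTerm x q n - (-1) ^ n * q ^ (3 * tri n + ((3 : ℕ) - 3) * n) := by
    intro n
    have hk : 1 - x * q ^ n ≠ 0 := sub_ne_zero.2 (h n).symm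
    have hqk := zpow_ne_zero n hq0
    have e1 : q / x * q ^ (-1 - n) = (x * q ^ n)⁻¹ := by
      rw [zpow_sub₀ hq0, zpow_neg_one]
      field_simp
    have e2 : tri (-1 - n) = tri n := by
      have := two_mul_tri (-1 - n)
      have := two_mul_tri n
      linarith
    have e3 : (-1 : ℂ) ^ (-1 - n) = -(-1) ^ n := by
      rw [zpow_sub₀ (by norm_num), zpow_neg_one, div_eq_iff (zpow_ne_zero _ (by norm_num)), neg_mul,
        neg_one_zpow_mul_self]
      norm_num
    have e4 : 1 - (x * q ^ n)⁻¹ = -(1 - x * q ^ n) / (x * q ^ n) := by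
      field_simp
      ring
    rw [appellTerm, appellTerm, e1, e2, e3, e4, Nat.cast_ofNat, sub_self, zero_mul, add_zero]
    field_simp
    ring
  have hs := (Equiv.subLeft (-1 : ℤ)).tsum_eq (appellTerm (q / x) q)
  simp only [Equiv.subLeft_apply] at hs
  rw [appell, ← hs, tsum_congr key, (summable_appellTerm hq1 hq0 hx).tsum_sub s, h0, sub_zero,
    ← appell]

/-! ### Analyticity, zeros and simple poles -/

theorem differentiable_qPochInf {q : ℂ} (hq1 : ‖q‖ < 1) :
    Differentiable ℂ (fun x => qPochInf x q) := by
  intro a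
  set U := Metric.ball (0 : ℂ) (‖a‖ + 1)
  have hU : IsOpen U := Metric.isOpen_ball
  have h := Summable.hasProdLocallyUniformlyOn_nat_one_add (f := fun (n : ℕ) (x : ℂ) => -(q ^ n * x))
    (u := fun n => ‖q‖ ^ n * (‖a‖ + 1)) hU
    ((summable_geometric_of_lt_one (norm_nonneg q) hq1).mul_right _)
    (Eventually.of_forall fun n x hx => by
      rw [norm_neg, norm_mul, norm_pow]
      gcongr
      exact (mem_ball_zero_iff.1 hx).le) (fun n => by fun_prop)
  have hd := h.differentiableOn (Eventually.of_forall fun s => by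
    simpa [Finset.prod_fn] using DifferentiableOn.finsetProd (fun _ _ => by fun_prop)) hU
  have ha : a ∈ U := mem_ball_zero_iff.2 (lt_add_one _)
  simpa [qPochInf, sub_eq_add_neg] using hd.differentiableAt (hU.mem_nhds ha)

theorem analyticAt_theta {q : ℂ} (hq1 : ‖q‖ < 1) {a : ℂ} (ha : a ≠ 0) :
    AnalyticAt ℂ (fun x => theta x q) a := by
  have h : DifferentiableOn ℂ (fun x => theta x q) {0}ᶜ := by
    intro x hx
    have hd := differentiable_qPochInf hq1
    have h1 : DifferentiableAt ℂ (fun x => qPochInf (q / x) q) x :=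
      (hd (q / x)).comp x (by
        have : x ≠ 0 := hx
        fun_prop (disch := assumption))
    exact (((hd x).mul h1).mul_const _).differentiableWithinAt
  exact h.analyticAt (isOpen_compl_singleton.mem_nhds ha)

theorem theta_q_mul {q : ℂ} (hq1 : ‖q‖ < 1) (hq0 : q ≠ 0) {x : ℂ} (hx : x ≠ 0) :
    theta (q * x) q = -x⁻¹ * theta x q := by
  rw [theta, theta, show q / (q * x) = x⁻¹ by field_simp, qPochInf_eq_mul hq1 x,
    qPochInf_eq_mul hq1 x⁻¹, ← div_eq_mul_inv]
  field_simp
  ring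

theorem qPochInf_eq_zero {x q : ℂ} (i : ℕ) (h : q ^ i * x = 1) : qPochInf x q = 0 :=
  tprod_of_exists_eq_zero ⟨i, sub_eq_zero.2 h.symm⟩

theorem theta_eq_zero {x q : ℂ} (hq0 : q ≠ 0) {n : ℤ} (h : x * q ^ n = 1) : theta x q = 0 := by
  rcases lt_or_ge n 0 with hn | hn
  · obtain ⟨m, rfl⟩ : ∃ m : ℕ, n = -(m + 1 : ℕ) := ⟨(-n - 1).toNat, by omega⟩
    have hx : x = q ^ (m + 1) := by
      rw [zpow_neg, zpow_natCast] at h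
      exact (eq_of_mul_inv_eq_one h)
    rw [theta, qPochInf_eq_zero (x := q / x) m (by rw [hx, pow_succ]; field_simp)]
    simp
  · lift n to ℕ using hn
    rw [theta, qPochInf_eq_zero (x := x) n (by rw [mul_comm]; exact_mod_cast h)]
    simp

theorem NotPower.theta_ne_zero {x q : ℂ} (h : NotPower x q) (hq1 : ‖q‖ < 1) (hq0 : q ≠ 0)
    (hx : x ≠ 0) : theta x q ≠ 0 := by
  refine mul_ne_zero (mul_ne_zero (qPochInf_ne_zero hq1 fun i hi => ?_)
    (qPochInf_ne_zero hq1 fun i hi => ?_)) (qPochInf_self_ne_zero hq1)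
  · exact h i (by rw [mul_comm]; exact_mod_cast hi)
  · refine h (-(i + 1 : ℕ)) ?_
    rw [zpow_neg, zpow_natCast, ← inv_eq_one, mul_inv, inv_inv, ← hi, pow_succ]
    field_simp

/-- `f` has at most a simple pole at `a`. -/
def SimplePole (f : ℂ → ℂ) (a : ℂ) : Prop :=
  ∃ k : ℂ → ℂ, AnalyticAt ℂ k a ∧ f =ᶠ[𝓝[≠] a] fun x => k x / (x - a)

theorem SimplePole.of_analyticAt {f : ℂ → ℂ} {a : ℂ} (h : AnalyticAt ℂ f a) : SimplePole f a := by
  refine ⟨fun x => f x * (x - a), by fun_prop, ?_⟩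
  filter_upwards [self_mem_nhdsWithin] with x hx
  rw [mul_div_cancel_right₀ _ (sub_ne_zero.2 hx)]

theorem SimplePole.add {f g : ℂ → ℂ} {a : ℂ} (hf : SimplePole f a) (hg : SimplePole g a) :
    SimplePole (fun x => f x + g x) a := by
  obtain ⟨k, hk, hfk⟩ := hf
  obtain ⟨l, hl, hgl⟩ := hg
  refine ⟨fun x => k x + l x, hk.add hl, ?_⟩
  filter_upwards [hfk, hgl] with x h1 h2
  rw [h1, h2, add_div]

theorem SimplePole.analyticAt_mul {f g : ℂ → ℂ} {a : ℂ} (hf : AnalyticAt ℂ f a)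
    (hg : SimplePole g a) : SimplePole (fun x => f x * g x) a := by
  obtain ⟨l, hl, hgl⟩ := hg
  refine ⟨fun x => f x * l x, hf.mul hl, ?_⟩
  filter_upwards [hgl] with x h2
  rw [h2, mul_div_assoc]

theorem SimplePole.sum {ι : Type*} (s : Finset ι) {f : ι → ℂ → ℂ} {a : ℂ}
    (hf : ∀ i, SimplePole (f i) a) : SimplePole (fun x => ∑ i ∈ s, f i x) a := by
  classical
  induction s using Finset.induction_on with
  | empty => simpa using SimplePole.of_analyticAt (analyticAt_const (v := (0 : ℂ)))
  | insert i s hi ih =>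
    simp only [Finset.sum_insert hi]
    exact (hf i).add ih

theorem SimplePole.congr {f g : ℂ → ℂ} {a : ℂ} (hf : SimplePole f a) (h : g =ᶠ[𝓝[≠] a] f) :
    SimplePole g a := by
  obtain ⟨k, hk, hfk⟩ := hf
  exact ⟨k, hk, h.trans hfk⟩

/-- Near a, f is (x - a) times the analytic function `dslope f a`, and x - a cancels the pole. -/
theorem SimplePole.exists_analyticAt_mul {f g : ℂ → ℂ} {a : ℂ} (hf : AnalyticAt ℂ f a)
    (hfa : f a = 0) (hg : SimplePole g a) :
    ∃ h, AnalyticAt ℂ h a ∧ (fun x => f x * g x) =ᶠ[𝓝[≠] a] h := by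
  obtain ⟨l, hl, hgl⟩ := hg
  obtain ⟨p, hp⟩ := hf
  have hd : AnalyticAt ℂ (dslope f a) a := ⟨_, hp.has_fpower_series_dslope_fslope⟩
  refine ⟨fun x => dslope f a x * l x, hd.mul hl, ?_⟩
  filter_upwards [hgl, self_mem_nhdsWithin] with x h1 hx
  have hx' : x - a ≠ 0 := sub_ne_zero.2 hx
  have h2 := sub_smul_dslope f a x
  rw [hfa, sub_zero, smul_eq_mul] at h2
  rw [h1, ← h2]
  field_simp

theorem tendsto_mul_sq_nhdsNE {c a : ℂ} (hc : c ≠ 0) (ha : a ≠ 0) :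
    Tendsto (fun x => c * x ^ 2) (𝓝[≠] a) (𝓝[≠] (c * a ^ 2)) := by
  refine tendsto_nhdsWithin_of_tendsto_nhds_of_eventually_within _
    ((by fun_prop : Continuous fun x : ℂ => c * x ^ 2).continuousAt.tendsto.mono_left
      nhdsWithin_le_nhds) ?_
  have h1 : ∀ᶠ x in 𝓝[≠] a, x ≠ -a := by
    refine eventually_nhdsWithin_of_eventually_nhds (isOpen_ne.mem_nhds fun h => ha ?_)
    linear_combination (1 / 2 : ℂ) * h
  filter_upwards [h1, self_mem_nhdsWithin] with x hx1 hx2 h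
  have h3 := mul_left_cancel₀ hc h
  rcases sq_eq_sq_iff_eq_or_eq_neg.1 h3 with h4 | h4
  · exact hx2 h4
  · exact hx1 h4

theorem SimplePole.comp_mul_sq {f : ℂ → ℂ} {c a : ℂ} (hc : c ≠ 0) (ha : a ≠ 0)
    (hf : SimplePole f (c * a ^ 2)) : SimplePole (fun x => f (c * x ^ 2)) a := by
  obtain ⟨k, hk, hfk⟩ := hf
  have hne : c * (a + a) ≠ 0 := mul_ne_zero hc (by simpa [← two_mul] using ha)
  refine ⟨fun x => k (c * x ^ 2) * (c * (x + a))⁻¹, ?_, ?_⟩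
  · have h1 : AnalyticAt ℂ (fun x : ℂ => c * x ^ 2) a := by fun_prop
    have h2 : AnalyticAt ℂ (fun x : ℂ => c * (x + a)) a := by fun_prop
    exact (hk.fun_comp (f := fun x : ℂ => c * x ^ 2) h1).mul (h2.inv hne)
  · have h := (tendsto_mul_sq_nhdsNE hc ha).eventually hfk
    filter_upwards [h] with x hx
    rw [hx, show c * x ^ 2 - c * a ^ 2 = c * (x + a) * (x - a) by ring, div_mul_eq_div_div,
      div_eq_mul_inv (k _)]

theorem simplePole_inv_one_sub_mul (b a : ℂ) : SimplePole (fun x => (1 - x * b)⁻¹) a := by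
  by_cases h : 1 - a * b = 0
  · have hb : b ≠ 0 := by
      rintro rfl
      simp at h
    refine ⟨fun _ => -b⁻¹, analyticAt_const, ?_⟩
    filter_upwards [self_mem_nhdsWithin] with x hx
    have hx' : x - a ≠ 0 := sub_ne_zero.2 hx
    rw [show 1 - x * b = -b * (x - a) by linear_combination h]
    field_simp
  · exact SimplePole.of_analyticAt
      ((by fun_prop : AnalyticAt ℂ (fun x : ℂ => 1 - x * b) a).inv h)

/-- Only finitely many terms can have poles near a; the rest converge uniformly there. The index m
is forced into the finite part so that a chosen polar term can be singled out. -/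
theorem exists_appell_eq_sum_add {q : ℂ} (hq1 : ‖q‖ < 1) (hq0 : q ≠ 0) {a : ℂ} (ha : a ≠ 0)
    (m : ℤ) : ∃ (N : Finset ℤ) (T : ℂ → ℂ), m ∈ N ∧ AnalyticAt ℂ T a ∧
      ∀ᶠ x in 𝓝 a, appell x q = ∑ n ∈ N, appellTerm x q n + T x := by
  classical
  obtain ⟨N, hN⟩ := exists_finset_half_le_norm hq1 hq0 ha
  have ha' := norm_pos_iff.2 ha
  refine ⟨insert m N, fun x => ∑' n : {n : ℤ // n ∉ insert m N}, appellTerm x q n,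
    Finset.mem_insert_self _ _, ?_, ?_⟩
  · set U : Set ℂ := {x | ‖a‖ / 2 < ‖x‖} ∩ {x | ‖x‖ < 2 * ‖a‖}
    have hU : IsOpen U := (isOpen_lt continuous_const continuous_norm).inter
      (isOpen_lt continuous_norm continuous_const)
    have haU : a ∈ U := ⟨by simp only [Set.mem_ofPred_eq]; linarith,
      by simp only [Set.mem_ofPred_eq]; linarith⟩
    have hb : ∀ n : {n : ℤ // n ∉ insert m N}, ∀ x ∈ U, 1 / 2 ≤ ‖1 - x * q ^ (n : ℤ)‖ :=
      fun n x hx => hN n (fun h => n.2 (Finset.mem_insert_of_mem h)) x hx.1.le hx.2.le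
    refine (Complex.differentiableOn_tsum_of_summable_norm
      (u := fun n : {n : ℤ // n ∉ insert m N} => ‖q ^ (3 * tri n)‖ * 2)
      (((summable_norm_zpow_three_mul_tri hq1 hq0).mul_right 2).subtype _) ?_ hU ?_).analyticAt
      (hU.mem_nhds haU)
    · intro n x hx
      have h0 : 1 - x * q ^ (n : ℤ) ≠ 0 := norm_pos_iff.1 (by linarith [hb n x hx])
      have h1 : DifferentiableAt ℂ (fun x => 1 - x * q ^ (n : ℤ)) x := by fun_prop
      exact ((h1.inv h0).const_mul _).differentiableWithinAt
    · intro n x hx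
      simp only [appellTerm, norm_mul, norm_zpow, norm_neg, norm_one, one_zpow, one_mul]
      gcongr
      rw [norm_inv]
      exact (inv_anti₀ (by norm_num) (hb n x hx)).trans (by norm_num)
  · filter_upwards [isOpen_ne.mem_nhds ha] with x hx
    exact ((summable_appellTerm hq1 hq0 hx).sum_add_tsum_subtype_compl (insert m N)).symm

theorem simplePole_appell {q : ℂ} (hq1 : ‖q‖ < 1) (hq0 : q ≠ 0) {a : ℂ} (ha : a ≠ 0) :
    SimplePole (fun x => appell x q) a := by
  obtain ⟨N, T, -, hT, h⟩ := exists_appell_eq_sum_add hq1 hq0 ha 0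
  refine ((SimplePole.sum N fun n => ?_).add (SimplePole.of_analyticAt hT)).congr
    (eventually_nhdsWithin_of_eventually_nhds h)
  exact (simplePole_inv_one_sub_mul (q ^ n) a).analyticAt_mul analyticAt_const

theorem analyticAt_appellTerm {q a : ℂ} {n : ℤ} (h : a * q ^ n ≠ 1) :
    AnalyticAt ℂ (fun x => appellTerm x q n) a :=
  analyticAt_const.mul ((by fun_prop : AnalyticAt ℂ (fun x : ℂ => 1 - x * q ^ n) a).inv
    (sub_ne_zero.2 h.symm))

theorem analyticAt_appell {q : ℂ} (hq1 : ‖q‖ < 1) (hq0 : q ≠ 0) {a : ℂ} (ha : a ≠ 0)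
    (h : NotPower a q) : AnalyticAt ℂ (fun x => appell x q) a := by
  obtain ⟨N, T, -, hT, he⟩ := exists_appell_eq_sum_add hq1 hq0 ha 0
  refine AnalyticAt.congr ?_ (EventuallyEq.symm he)
  exact (Finset.analyticAt_fun_sum N fun n _ => analyticAt_appellTerm (h n)).add hT

theorem norm_zpow_ne_one {q : ℂ} (hq1 : ‖q‖ < 1) {n : ℤ} (hn : n ≠ 0) :
    ‖q ^ n‖ ≠ 1 := by
  rw [norm_zpow]
  intro h
  exact hn ((zpow_eq_one_iff_right₀ (norm_nonneg q) hq1.ne).1 h)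

/-- Among all terms only n = 0, which is 1 / (1 - x), is singular at 1. -/
theorem tendsto_one_sub_mul_appell {q : ℂ} (hq1 : ‖q‖ < 1) (hq0 : q ≠ 0) :
    Tendsto (fun x => (1 - x) * appell x q) (𝓝[≠] 1) (𝓝 1) := by
  classical
  obtain ⟨N, T, h0, hT, he⟩ := exists_appell_eq_sum_add hq1 hq0 one_ne_zero 0
  have hA : AnalyticAt ℂ (fun x => ∑ n ∈ N.erase 0, appellTerm x q n + T x) 1 := by
    refine (Finset.analyticAt_fun_sum _ fun n hn => analyticAt_appellTerm fun h => ?_).add hT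
    refine norm_zpow_ne_one hq1 (Finset.ne_of_mem_erase hn) ?_
    rw [one_mul] at h
    rw [h, norm_one]
  have hlim : Tendsto (fun x => 1 + (1 - x) * (∑ n ∈ N.erase 0, appellTerm x q n + T x))
      (𝓝[≠] 1) (𝓝 1) := by
    have hc : ContinuousAt
        (fun x => 1 + (1 - x) * (∑ n ∈ N.erase 0, appellTerm x q n + T x)) 1 :=
      continuousAt_const.add ((continuousAt_const.sub continuousAt_id).mul hA.continuousAt)
    simpa [ContinuousAt] using hc.tendsto.mono_left (nhdsWithin_le_nhds (s := {1}ᶜ))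
  refine hlim.congr' ?_
  filter_upwards [eventually_nhdsWithin_of_eventually_nhds he, self_mem_nhdsWithin] with x hx hx1
  have h1 : 1 - x ≠ 0 := sub_ne_zero.2 (Ne.symm hx1)
  rw [hx, ← Finset.add_sum_erase N _ h0]
  simp only [appellTerm, zpow_zero, tri_zero, mul_zero, mul_one, one_mul]
  field_simp
  ring

theorem eventually_notPower {q : ℂ} (hq1 : ‖q‖ < 1) (hq0 : q ≠ 0) {a : ℂ} (ha : a ≠ 0) :
    ∀ᶠ x in 𝓝[≠] a, NotPower x q := by
  obtain ⟨N, hN⟩ := exists_finset_half_le_norm hq1 hq0 ha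
  have ha' := norm_pos_iff.2 ha
  have h1 : ∀ᶠ x in 𝓝[≠] a, ‖a‖ / 2 < ‖x‖ := eventually_nhdsWithin_of_eventually_nhds
    ((isOpen_lt continuous_const continuous_norm).mem_nhds (by simp only [Set.mem_ofPred_eq]; linarith))
  have h2 : ∀ᶠ x in 𝓝[≠] a, ‖x‖ < 2 * ‖a‖ := eventually_nhdsWithin_of_eventually_nhds
    ((isOpen_lt continuous_norm continuous_const).mem_nhds (by simp only [Set.mem_ofPred_eq]; linarith))
  have h3 : ∀ᶠ x in 𝓝[≠] a, ∀ n ∈ N, x * q ^ n ≠ 1 := by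
    rw [Filter.eventually_all_finset]
    intro n _
    by_cases h : a * q ^ n = 1
    · filter_upwards [self_mem_nhdsWithin] with x hx hx1
      exact hx (mul_right_cancel₀ (zpow_ne_zero n hq0) (hx1.trans h.symm))
    · exact eventually_nhdsWithin_of_eventually_nhds
        ((by fun_prop : Continuous fun x : ℂ => x * q ^ n).continuousAt.eventually_ne h)
  filter_upwards [h1, h2, h3] with x hx1 hx2 hx3 n hn
  by_cases hnN : n ∈ N
  · exact hx3 n hnN hn
  · have := hN n hnN x hx1.le hx2.le
    rw [hn, sub_self, norm_zero] at this
    norm_num at this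

/-! ### A Liouville theorem for q-periodic functions -/

/-- A function on the punctured plane which is invariant under multiplication by `q` and has only
removable singularities is constant. -/
theorem exists_tendsto_const_of_periodic {q : ℂ} (hq1 : ‖q‖ < 1) (hq0 : q ≠ 0) {F : ℂ → ℂ}
    (hrem : ∀ a ≠ 0, ∃ h, AnalyticAt ℂ h a ∧ F =ᶠ[𝓝[≠] a] h)
    (hper : ∀ a ≠ 0, ∀ᶠ x in 𝓝[≠] a, F (q * x) = F x) :
    ∃ c, ∀ a ≠ 0, Tendsto F (𝓝[≠] a) (𝓝 c) := by
  have hex : ∀ a : ℂ, ∃ c : ℂ, a ≠ 0 → Tendsto F (𝓝[≠] a) (𝓝 c) := by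
    intro a
    by_cases ha : a = 0
    · exact ⟨0, fun h => absurd ha h⟩
    · obtain ⟨h, hh, hF⟩ := hrem a ha
      exact ⟨h a, fun _ => (hh.continuousAt.tendsto.mono_left nhdsWithin_le_nhds).congr' hF.symm⟩
  choose G hG using hex
  -- The limit function G coincides near a with the local analytic extension of F, by uniqueness of
  -- limits.
  have hGa : ∀ a ≠ 0, AnalyticAt ℂ G a := by
    intro a ha
    obtain ⟨h, hh, hF⟩ := hrem a ha
    refine hh.congr ?_
    have hF2 : ∀ᶠ y in 𝓝[≠] a, h y = G y := by
      have hF' := eventually_eventually_nhdsWithin.2 hF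
      filter_upwards [hF', self_mem_nhdsWithin,
        eventually_nhdsWithin_of_eventually_nhds hh.eventually_analyticAt,
        eventually_nhdsWithin_of_eventually_nhds (isOpen_ne.mem_nhds ha)] with y hy hya hhy hy0
      rw [IsOpen.nhdsWithin_eq isOpen_compl_singleton hya] at hy
      refine tendsto_nhds_unique (hhy.continuousAt.tendsto.mono_left
        (nhdsWithin_le_nhds (s := {y}ᶜ))) ((hG y hy0).congr' ?_)
      exact eventually_nhdsWithin_of_eventually_nhds hy
    have hFa : h a = G a := tendsto_nhds_unique ((hh.continuousAt.tendsto.mono_left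
      nhdsWithin_le_nhds).congr' hF.symm) (hG a ha)
    rw [eventually_nhdsWithin_iff] at hF2
    filter_upwards [hF2] with y hy
    by_cases hya : y = a
    · rw [hya, hFa]
    · exact hy hya
  have hGper : ∀ a ≠ 0, G (q * a) = G a := by
    intro a ha
    have ht : Tendsto (fun x => q * x) (𝓝[≠] a) (𝓝[≠] (q * a)) := by
      refine tendsto_nhdsWithin_of_tendsto_nhds_of_eventually_within _
        ((by fun_prop : Continuous fun x : ℂ => q * x).continuousAt.tendsto.mono_left
          nhdsWithin_le_nhds) ?_
      filter_upwards [self_mem_nhdsWithin] with x hx h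
      exact hx (mul_left_cancel₀ hq0 h)
    exact tendsto_nhds_unique (((hG (q * a) (mul_ne_zero hq0 ha)).comp ht).congr' (hper a ha))
      (hG a ha)
  have hGnat : ∀ (n : ℕ), ∀ a ≠ 0, G (q ^ n * a) = G a := by
    intro n a ha
    induction n with
    | zero => simp
    | succ n ih => rw [pow_succ', mul_assoc, hGper _ (mul_ne_zero (pow_ne_zero n hq0) ha), ih]
  have hGint : ∀ (n : ℤ), ∀ a ≠ 0, G (q ^ n * a) = G a := by
    intro n a ha
    obtain ⟨m, rfl | rfl⟩ := n.eq_nat_or_neg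
    · exact_mod_cast hGnat m a ha
    · have := hGnat m (q ^ (-(m : ℤ)) * a) (mul_ne_zero (zpow_ne_zero _ hq0) ha)
      rw [zpow_neg, zpow_natCast, mul_inv_cancel_left₀ (pow_ne_zero m hq0)] at this
      rw [zpow_neg, zpow_natCast, ← this]
  -- The closed annulus |q| ≤ |x| ≤ 1 is compact and meets every orbit of multiplication by q, so G
  -- is bounded.
  set K : Set ℂ := Metric.closedBall 0 1 ∩ {x | ‖q‖ ≤ ‖x‖} with hK
  have hKc : IsCompact K := (isCompact_closedBall (0 : ℂ) 1).inter_right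
    (isClosed_le continuous_const continuous_norm)
  have hq' := norm_pos_iff.2 hq0
  have hKcont : ContinuousOn G K := fun x hx =>
    (hGa x (norm_pos_iff.1 (hq'.trans_le hx.2))).continuousAt.continuousWithinAt
  obtain ⟨M, hM⟩ := (hKc.image_of_continuousOn hKcont).isBounded.exists_norm_le
  have hbound : ∀ a ≠ 0, ‖G a‖ ≤ M := by
    intro a ha
    obtain ⟨n, hn1, hn2⟩ := exists_mem_Ioc_zpow (norm_pos_iff.2 ha) ((one_lt_inv₀ hq').2 hq1)
    rw [← hGint (n + 1) a ha]
    refine hM _ ⟨_, ⟨?_, ?_⟩, rfl⟩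
    · rw [mem_closedBall_zero_iff, norm_mul, norm_zpow]
      rw [inv_zpow] at hn2
      rwa [← le_inv_mul_iff₀ (zpow_pos hq' _), mul_one]
    · rw [Set.mem_ofPred_eq, norm_mul, norm_zpow, zpow_add₀ hq'.ne', zpow_one]
      rw [inv_zpow, inv_lt_iff_one_lt_mul₀' (zpow_pos hq' _)] at hn1
      nlinarith
  -- Composition with exp yields a bounded entire function, to which Liouville applies.
  have hent : Differentiable ℂ (fun w => G (Complex.exp w)) := fun w =>
    (hGa _ (Complex.exp_ne_zero w)).differentiableAt.comp w Complex.differentiable_exp.differentiableAt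
  have hbd : Bornology.IsBounded (Set.range fun w => G (Complex.exp w)) := by
    refine isBounded_iff_forall_norm_le.2 ⟨M, ?_⟩
    rintro _ ⟨w, rfl⟩
    exact hbound _ (Complex.exp_ne_zero w)
  refine ⟨G 1, fun a ha => ?_⟩
  have := hent.apply_eq_apply_of_bounded hbd (Complex.log a) 0
  rw [Complex.exp_log ha, Complex.exp_zero] at this
  rw [← this]
  exact hG a ha

/-! ### The quadratic relation between bases q and q⁴ -/

/-- The function `x j(x; q) j(-q x²; q²)`. -/
noncomputable def thetaProd (q x : ℂ) : ℂ := x * theta x q * theta (-q * x ^ 2) (q ^ 2)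

/-- The combination of Appell–Lerch type series of bases `q` and `q ^ 4` whose product with
`thetaProd q` is constant. -/
noncomputable def appellComb (q x : ℂ) : ℂ :=
  (qPochInf q q)⁻¹ * appell x q
    + -((q ^ 2)⁻¹ * (qPochInf (q ^ 4) (q ^ 4))⁻¹) * x ^ 3 * appell (-q⁻¹ * x ^ 2) (q ^ 4)
    + q * (qPochInf (q ^ 4) (q ^ 4))⁻¹ * appell (-q * x ^ 2) (q ^ 4) + q⁻¹ * x

theorem thetaProd_q_mul {q : ℂ} (hq1 : ‖q‖ < 1) (hq0 : q ≠ 0) {x : ℂ} (hx : x ≠ 0) :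
    thetaProd q (q * x) = -(x ^ 3)⁻¹ * thetaProd q x := by
  have h2 := norm_pow_lt_one hq1 two_ne_zero
  have h := theta_q_mul h2 (pow_ne_zero 2 hq0) (mul_ne_zero (neg_ne_zero.2 hq0) (pow_ne_zero 2 hx))
  rw [thetaProd, thetaProd, theta_q_mul hq1 hq0 hx,
    show -q * (q * x) ^ 2 = q ^ 2 * (-q * x ^ 2) by ring, h]
  field_simp

/-- The substitution sends -q⁻¹x² to -qx², and -qx² to q⁴(-q⁻¹x²), so the two base-q⁴ series trade
places. The term q⁻¹x absorbs the inhomogeneous parts. -/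
theorem appellComb_q_mul {q : ℂ} (hq1 : ‖q‖ < 1) (hq0 : q ≠ 0) {x : ℂ} (hx : x ≠ 0)
    (h1 : NotPower x q) (h2 : NotPower (-q⁻¹ * x ^ 2) (q ^ 4)) :
    appellComb q (q * x) = -x ^ 3 * appellComb q x := by
  have hJ := qPochInf_self_ne_zero hq1
  have h4 := norm_pow_lt_one hq1 four_ne_zero
  have hJ4 := qPochInf_self_ne_zero h4
  have e := appell_q_mul h4 (pow_ne_zero 4 hq0)
    (mul_ne_zero (neg_ne_zero.2 (inv_ne_zero hq0)) (pow_ne_zero 2 hx)) h2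
  rw [appellComb, appellComb, appell_q_mul hq1 hq0 hx h1,
    show -q⁻¹ * (q * x) ^ 2 = -q * x ^ 2 by field_simp,
    show -q * (q * x) ^ 2 = q ^ 4 * (-q⁻¹ * x ^ 2) by field_simp, e]
  field_simp
  ring

theorem analyticAt_thetaProd {q : ℂ} (hq1 : ‖q‖ < 1) (hq0 : q ≠ 0) {a : ℂ} (ha : a ≠ 0) :
    AnalyticAt ℂ (thetaProd q) a := by
  have h1 : AnalyticAt ℂ (fun x : ℂ => -q * x ^ 2) a := by fun_prop
  have h2 := analyticAt_theta (norm_pow_lt_one hq1 two_ne_zero)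
    (mul_ne_zero (neg_ne_zero.2 hq0) (pow_ne_zero 2 ha))
  exact (analyticAt_id.mul (analyticAt_theta hq1 ha)).mul
    (h2.fun_comp (f := fun x : ℂ => -q * x ^ 2) h1)

theorem simplePole_appellComb {q : ℂ} (hq1 : ‖q‖ < 1) (hq0 : q ≠ 0) {a : ℂ} (ha : a ≠ 0) :
    SimplePole (appellComb q) a := by
  have h4 := norm_pow_lt_one hq1 four_ne_zero
  have hq4 := pow_ne_zero 4 hq0
  have hc1 : -q⁻¹ ≠ 0 := neg_ne_zero.2 (inv_ne_zero hq0)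
  have hc2 : -q ≠ 0 := neg_ne_zero.2 hq0
  have s1 := simplePole_appell hq1 hq0 ha
  have s2 := (simplePole_appell h4 hq4 (mul_ne_zero hc1 (pow_ne_zero 2 ha))).comp_mul_sq hc1 ha
  have s3 := (simplePole_appell h4 hq4 (mul_ne_zero hc2 (pow_ne_zero 2 ha))).comp_mul_sq hc2 ha
  exact (((s1.analyticAt_mul (by fun_prop)).add (s2.analyticAt_mul (by fun_prop))).add
    (s3.analyticAt_mul (by fun_prop))).add (SimplePole.of_analyticAt (by fun_prop))

theorem analyticAt_appell_mul_sq {q : ℂ} (hq1 : ‖q‖ < 1) (hq0 : q ≠ 0) {a c : ℂ} (ha : a ≠ 0)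
    (hc : c ≠ 0) (h : NotPower (c * a ^ 2) q) : AnalyticAt ℂ (fun x => appell (c * x ^ 2) q) a := by
  have e : AnalyticAt ℂ (fun x : ℂ => c * x ^ 2) a := by fun_prop
  exact (analyticAt_appell hq1 hq0 (mul_ne_zero hc (pow_ne_zero 2 ha)) h).fun_comp
    (f := fun x : ℂ => c * x ^ 2) e

theorem analyticAt_appellComb {q : ℂ} (hq1 : ‖q‖ < 1) (hq0 : q ≠ 0) {a : ℂ} (ha : a ≠ 0)
    (h1 : NotPower a q) (h2 : NotPower (-q⁻¹ * a ^ 2) (q ^ 4)) (h3 : NotPower (-q * a ^ 2) (q ^ 4)) :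
    AnalyticAt ℂ (appellComb q) a := by
  have h4 := norm_pow_lt_one hq1 four_ne_zero
  have hq4 := pow_ne_zero 4 hq0
  have s1 := analyticAt_appell hq1 hq0 ha h1
  have s2 := analyticAt_appell_mul_sq h4 hq4 ha (neg_ne_zero.2 (inv_ne_zero hq0)) h2
  have s3 := analyticAt_appell_mul_sq h4 hq4 ha (neg_ne_zero.2 hq0) h3
  unfold appellComb
  fun_prop

/-- Every pole of a summand of `appellComb` is a zero of `thetaProd`: the two base-q⁴ series account
for odd and even powers of q² in the zeros of j(-qx²; q²). -/
theorem notPower_of_thetaProd_ne_zero {q : ℂ} (hq0 : q ≠ 0) {a : ℂ} (h : thetaProd q a ≠ 0) :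
    NotPower a q ∧ NotPower (-q⁻¹ * a ^ 2) (q ^ 4) ∧ NotPower (-q * a ^ 2) (q ^ 4) := by
  have h1 := right_ne_zero_of_mul (left_ne_zero_of_mul h)
  have h2 := right_ne_zero_of_mul h
  have e : ∀ n : ℤ, (q ^ 4) ^ n = ((q ^ 2) ^ n) ^ 2 := by
    intro n
    rw [show q ^ 4 = q ^ 2 * q ^ 2 by ring, mul_zpow]
    exact (sq _).symm
  refine ⟨fun n hn => h1 (theta_eq_zero hq0 hn), fun n hn => h2 (theta_eq_zero
    (pow_ne_zero 2 hq0) (n := 2 * n - 1) ?_), fun n hn => h2 (theta_eq_zero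
    (pow_ne_zero 2 hq0) (n := 2 * n) ?_)⟩
  · rw [← hn, e, zpow_sub₀ (pow_ne_zero 2 hq0), mul_comm 2 n, zpow_mul, zpow_one,
      show ((q ^ 2) ^ n) ^ (2 : ℤ) = ((q ^ 2) ^ n) ^ 2 from zpow_natCast _ 2]
    field_simp
  · rw [← hn, e, mul_comm 2 n, zpow_mul,
      show ((q ^ 2) ^ n) ^ (2 : ℤ) = ((q ^ 2) ^ n) ^ 2 from zpow_natCast _ 2]

theorem notPower_of_norm_eq {q u : ℂ} (hq1 : ‖q‖ < 1) (hq0 : q ≠ 0) {k : ℤ} {m : ℕ}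
    (hu : ‖u‖ = ‖q‖ ^ k) (h : ∀ n : ℤ, k + m * n ≠ 0) : NotPower u (q ^ m) := by
  intro n hn
  have h1 := congrArg norm hn
  have hq' := norm_pos_iff.2 hq0
  rw [norm_mul, hu, norm_zpow, norm_pow, ← zpow_natCast, ← zpow_mul, ← zpow_add₀ hq'.ne',
    norm_one] at h1
  exact h n ((zpow_eq_one_iff_right₀ hq'.le hq1.ne).1 h1)

theorem thetaProd_eq {q : ℂ} (hq1 : ‖q‖ < 1) (x : ℂ) :
    thetaProd q x = (1 - x) * (x * (qPochInf (q * x) q * qPochInf (q / x) q * qPochInf q q) *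
      theta (-q * x ^ 2) (q ^ 2)) := by
  rw [thetaProd, theta, qPochInf_eq_mul hq1 x]
  ring

/-- At x = 1 `thetaProd` vanishes, so only the pole of the base-q series contributes; the base-q⁴
arguments -q^{±1} are excluded as poles by their modulus. -/
theorem tendsto_thetaProd_mul_appellComb {q : ℂ} (hq1 : ‖q‖ < 1) (hq0 : q ≠ 0) :
    Tendsto (fun x => thetaProd q x * appellComb q x) (𝓝[≠] 1)
      (𝓝 (qPochInf q q ^ 2 * theta (-q) (q ^ 2))) := by
  have hJ := qPochInf_self_ne_zero hq1
  have h4 := norm_pow_lt_one hq1 four_ne_zero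
  have hq4 := pow_ne_zero 4 hq0
  have hR : AnalyticAt ℂ (fun x =>
      -((q ^ 2)⁻¹ * (qPochInf (q ^ 4) (q ^ 4))⁻¹) * x ^ 3 * appell (-q⁻¹ * x ^ 2) (q ^ 4)
        + q * (qPochInf (q ^ 4) (q ^ 4))⁻¹ * appell (-q * x ^ 2) (q ^ 4) + q⁻¹ * x) 1 := by
    have s2 := analyticAt_appell_mul_sq h4 hq4 one_ne_zero (neg_ne_zero.2 (inv_ne_zero hq0))
      (notPower_of_norm_eq hq1 hq0 (k := -1) (by simp) (fun n => by push_cast; omega))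
    have s3 := analyticAt_appell_mul_sq h4 hq4 one_ne_zero (neg_ne_zero.2 hq0)
      (notPower_of_norm_eq hq1 hq0 (k := 1) (by simp) (fun n => by push_cast; omega))
    fun_prop
  have hΦ := (analyticAt_thetaProd hq1 hq0 one_ne_zero).continuousAt
  have hΦ1 : thetaProd q 1 = 0 := by simp [thetaProd_eq hq1]
  have hA : ContinuousAt (fun x => x * (qPochInf (q * x) q * qPochInf (q / x) q * qPochInf q q) *
      theta (-q * x ^ 2) (q ^ 2)) 1 := by
    have hc := (differentiable_qPochInf hq1).continuous
    have c1 : ContinuousAt (fun x => qPochInf (q * x) q) 1 :=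
      (hc.comp (continuous_const_mul q)).continuousAt
    have c2 : ContinuousAt (fun x => qPochInf (q / x) q) 1 :=
      hc.continuousAt.comp (f := fun x : ℂ => q / x)
        (continuousAt_const.div continuousAt_id one_ne_zero)
    have c3 : ContinuousAt (fun x => theta (-q * x ^ 2) (q ^ 2)) 1 := by
      have hθ : AnalyticAt ℂ (fun x => theta x (q ^ 2)) (-q * 1 ^ 2) :=
        analyticAt_theta (norm_pow_lt_one hq1 two_ne_zero) (by simpa using hq0)
      exact hθ.continuousAt.comp (f := fun x : ℂ => -q * x ^ 2) (by fun_prop)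
    fun_prop
  have t1 := (hA.tendsto.mono_left (nhdsWithin_le_nhds (s := {1}ᶜ))).mul
    ((tendsto_one_sub_mul_appell hq1 hq0).const_mul (qPochInf q q)⁻¹)
  have t2 := (hΦ.tendsto.mul hR.continuousAt.tendsto).mono_left (nhdsWithin_le_nhds (s := {1}ᶜ))
  rw [hΦ1, zero_mul] at t2
  have t := t1.add t2
  have hval : 1 * (qPochInf (q * 1) q * qPochInf (q / 1) q * qPochInf q q) *
      theta (-q * 1 ^ 2) (q ^ 2) * ((qPochInf q q)⁻¹ * 1) + 0 =
      qPochInf q q ^ 2 * theta (-q) (q ^ 2) := by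
    simp only [mul_one, div_one, one_pow]
    field_simp
    ring
  rw [hval] at t
  refine t.congr fun x => ?_
  rw [appellComb, thetaProd_eq hq1]
  ring

/-- The quadratic relation between the Appell–Lerch type series of bases `q` and `q ^ 4`. -/
theorem thetaProd_mul_appellComb {q : ℂ} (hq1 : ‖q‖ < 1) (hq0 : q ≠ 0) {x : ℂ} (hx : x ≠ 0)
    (h1 : NotPower x q) (h2 : NotPower (-q⁻¹ * x ^ 2) (q ^ 4)) (h3 : NotPower (-q * x ^ 2) (q ^ 4)) :
    thetaProd q x * appellComb q x = qPochInf q q ^ 2 * theta (-q) (q ^ 2) := by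
  have hc1 : -q⁻¹ ≠ 0 := neg_ne_zero.2 (inv_ne_zero hq0)
  have h4 := norm_pow_lt_one hq1 four_ne_zero
  have hq4 := pow_ne_zero 4 hq0
  have hrem : ∀ a ≠ 0, ∃ h, AnalyticAt ℂ h a ∧
      (fun x => thetaProd q x * appellComb q x) =ᶠ[𝓝[≠] a] h := by
    intro a ha
    -- A zero of `thetaProd` absorbs the at most simple pole; elsewhere both factors are analytic.
    by_cases h : thetaProd q a = 0
    · exact (simplePole_appellComb hq1 hq0 ha).exists_analyticAt_mul
        (analyticAt_thetaProd hq1 hq0 ha) h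
    · obtain ⟨n1, n2, n3⟩ := notPower_of_thetaProd_ne_zero hq0 h
      exact ⟨_, (analyticAt_thetaProd hq1 hq0 ha).mul (analyticAt_appellComb hq1 hq0 ha n1 n2 n3),
        EventuallyEq.rfl⟩
  have hper : ∀ a ≠ 0, ∀ᶠ x in 𝓝[≠] a, thetaProd q (q * x) * appellComb q (q * x) =
      thetaProd q x * appellComb q x := by
    intro a ha
    filter_upwards [eventually_notPower hq1 hq0 ha, (tendsto_mul_sq_nhdsNE hc1 ha).eventually
      (eventually_notPower h4 hq4 (mul_ne_zero hc1 (pow_ne_zero 2 ha))),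
      eventually_nhdsWithin_of_eventually_nhds (isOpen_ne.mem_nhds ha)] with x hx1 hx2 hx0
    rw [thetaProd_q_mul hq1 hq0 hx0, appellComb_q_mul hq1 hq0 hx0 hx1 hx2]
    have : x ^ 3 ≠ 0 := pow_ne_zero 3 hx0
    field_simp
  obtain ⟨c, hc⟩ := exists_tendsto_const_of_periodic hq1 hq0 hrem hper
  have hcv := tendsto_nhds_unique (hc 1 one_ne_zero) (tendsto_thetaProd_mul_appellComb hq1 hq0)
  have hcont := ((analyticAt_thetaProd hq1 hq0 hx).continuousAt.mul
    (analyticAt_appellComb hq1 hq0 hx h1 h2 h3).continuousAt).tendsto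
  rw [← hcv]
  exact tendsto_nhds_unique (hcont.mono_left (nhdsWithin_le_nhds (s := {x}ᶜ))) (hc x hx)

/-! ### Theta identities and the dissection of p g(p, p⁴) -/

/-- Repeated use of (y; q)_∞ (-y; q)_∞ = (y²; q²)_∞ collapses the factors in bases p⁴ and p⁸. It
serves to divide by the theta product in the quadratic relation. -/
theorem theta_mul_theta_neg_mul_theta {p : ℂ} (hp1 : ‖p‖ < 1) (hp0 : p ≠ 0) :
    theta p (p ^ 4) * theta (-p) (p ^ 4) * theta (-p ^ 6) (p ^ 8) =
      qPochInf (p ^ 4) (p ^ 4) ^ 3 := by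
  have h4 := norm_pow_lt_one hp1 four_ne_zero
  have h8 := norm_pow_lt_one hp1 (n := 8) (by norm_num)
  have e1 := qPochInf_mul_neg h4 p
  have e2 := qPochInf_mul_neg h4 (p ^ 3)
  have e3 := qPochInf_mul_neg h8 (p ^ 2)
  have e4 := qPochInf_mul_neg h8 (p ^ 6)
  have e5 := qPochInf_eq_mul_sq h4 (p ^ 4)
  have e6 := qPochInf_eq_mul_sq h8 (p ^ 4)
  simp only [← pow_mul, ← pow_add] at e1 e2 e3 e4 e5 e6
  norm_num at e1 e2 e3 e4 e5 e6
  rw [theta, theta, theta, show p ^ 4 / p = p ^ 3 by field_simp,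
    show p ^ 4 / -p = -p ^ 3 by field_simp, show p ^ 8 / -p ^ 6 = -p ^ 2 by field_simp]
  calc _ = (qPochInf p (p ^ 4) * qPochInf (-p) (p ^ 4)) *
        (qPochInf (p ^ 3) (p ^ 4) * qPochInf (-p ^ 3) (p ^ 4)) *
        (qPochInf (-p ^ 6) (p ^ 8) * qPochInf (-p ^ 2) (p ^ 8)) *
        (qPochInf (p ^ 8) (p ^ 8) * qPochInf (p ^ 4) (p ^ 4) ^ 2) := by ring
    _ = (qPochInf (p ^ 2) (p ^ 8) * qPochInf (-p ^ 2) (p ^ 8)) *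
        (qPochInf (p ^ 6) (p ^ 8) * qPochInf (-p ^ 6) (p ^ 8)) *
        (qPochInf (p ^ 8) (p ^ 8) * qPochInf (p ^ 4) (p ^ 4) ^ 2) := by rw [e1, e2]; ring
    _ = qPochInf (p ^ 4) (p ^ 8) * qPochInf (p ^ 8) (p ^ 8) * qPochInf (p ^ 4) (p ^ 4) ^ 2 := by
      rw [e3, e4, e6]; ring
    _ = qPochInf (p ^ 4) (p ^ 4) ^ 3 := by rw [← e5]; ring

theorem thetaTerm_neg_pow {p : ℂ} (hp0 : p ≠ 0) (j m : ℕ) (k : ℤ) :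
    thetaTerm (-p ^ j) (p ^ m) k = p ^ (m * tri k + (j - m) * k) := by
  have h : -(-p ^ j / p ^ m) = p ^ ((j : ℤ) - m) := by
    rw [zpow_sub₀ hp0, zpow_natCast, zpow_natCast]
    ring
  rw [thetaTerm, h, ← zpow_mul, zpow_add₀ hp0, ← zpow_natCast, ← zpow_mul]

theorem hasSum_int_even_add_odd {f : ℤ → ℂ} {a b : ℂ} (he : HasSum (fun k => f (2 * k)) a)
    (ho : HasSum (fun k => f (2 * k + 1)) b) : HasSum f (a + b) := by
  have i0 : Function.Injective fun k : ℤ => 2 * k := fun a b h => by simpa using h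
  have i1 : Function.Injective fun k : ℤ => 2 * k + 1 := fun a b h => by simpa using h
  have hcompl : IsCompl (Set.range fun k : ℤ => 2 * k) (Set.range fun k : ℤ => 2 * k + 1) := by
    refine IsCompl.of_eq ?_ ?_
    · ext n
      simp only [Set.inf_eq_inter, Set.mem_inter_iff, Set.mem_range, Set.bot_eq_empty,
        Set.mem_empty_iff_false, iff_false]
      rintro ⟨⟨a, ha⟩, b, hb⟩
      omega
    · ext n
      simp only [Set.sup_eq_union, Set.mem_union, Set.mem_range, Set.top_eq_univ, Set.mem_univ,
        iff_true]
      rcases Int.even_or_odd' n with ⟨k, hk | hk⟩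
      · exact Or.inl ⟨k, hk.symm⟩
      · exact Or.inr ⟨k, hk.symm⟩
  exact HasSum.add_isCompl hcompl (i0.hasSum_range_iff.2 he) (i1.hasSum_range_iff.2 ho)

/-- The `2`-dissection of the theta function `j(-p; p^4)`. -/
theorem theta_neg_self_dissection {p : ℂ} (hp1 : ‖p‖ < 1) (hp0 : p ≠ 0) :
    theta (-p) (p ^ 4) = theta (-p ^ 6) (p ^ 16) + p * theta (-p ^ 2) (p ^ 16) := by
  have h4 := norm_pow_lt_one hp1 four_ne_zero
  have h16 := norm_pow_lt_one hp1 (n := 16) (by norm_num)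
  have q4 := pow_ne_zero 4 hp0
  have q16 := pow_ne_zero 16 hp0
  have np : ∀ j : ℕ, -p ^ j ≠ 0 := fun j => neg_ne_zero.2 (pow_ne_zero j hp0)
  have e := theta_eq_tsum h4 q4 (np 1)
  rw [pow_one] at e
  have he : ∀ k : ℤ, thetaTerm (-p) (p ^ 4) (2 * k) = thetaTerm (-p ^ 6) (p ^ 16) k := by
    intro k
    have := thetaTerm_neg_pow hp0 1 4 (2 * k)
    rw [pow_one] at this
    rw [this, thetaTerm_neg_pow hp0]
    congr 1
    have a1 := two_mul_tri (2 * k)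
    have a2 := two_mul_tri k
    push_cast
    linarith
  -- Reflecting k yields the argument -p² rather than -p¹⁴.
  have ho : ∀ k : ℤ, thetaTerm (-p) (p ^ 4) (2 * k + 1) = p * thetaTerm (-p ^ 2) (p ^ 16) (-k) := by
    intro k
    have := thetaTerm_neg_pow hp0 1 4 (2 * k + 1)
    rw [pow_one] at this
    rw [this, thetaTerm_neg_pow hp0, ← zpow_one_add₀ hp0]
    congr 1
    have a1 := two_mul_tri (2 * k + 1)
    have a2 := two_mul_tri (-k)
    push_cast
    linarith
  have hE := (summable_norm_thetaTerm h16 q16 (np 6)).of_norm.hasSum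
  have hO := ((Equiv.neg ℤ).hasSum_iff.2
    (summable_norm_thetaTerm h16 q16 (np 2)).of_norm.hasSum).mul_left p
  rw [← theta_eq_tsum h16 q16 (np 6)] at hE
  rw [← theta_eq_tsum h16 q16 (np 2)] at hO
  simp only [Function.comp_def, Equiv.neg_apply, ← ho] at hO
  have hE' : HasSum (fun k => thetaTerm (-p) (p ^ 4) (2 * k)) (theta (-p ^ 6) (p ^ 16)) := by
    simpa only [he] using hE
  rw [e]
  exact (hasSum_int_even_add_odd hE' hO).tsum_eq

/-- The `2`-dissection of `p g(p, p^4)`. -/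
theorem mul_g_self_eq {p : ℂ} (hp1 : ‖p‖ < 1) (hp0 : p ≠ 0) :
    p * g p (p ^ 4) = -1 + p ^ 2 * g (-p ^ 2) (p ^ 16) - p ^ 5 * g (-p ^ 6) (p ^ 16) +
      theta (-p ^ 4) (p ^ 8) * (theta (-p ^ 6) (p ^ 16) + p * theta (-p ^ 2) (p ^ 16)) /
        qPochInf (p ^ 4) (p ^ 4) := by
  have h4 := norm_pow_lt_one hp1 four_ne_zero
  have h8 := norm_pow_lt_one hp1 (n := 8) (by norm_num)
  have h16 := norm_pow_lt_one hp1 (n := 16) (by norm_num)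
  have q4 := pow_ne_zero 4 hp0
  have q8 := pow_ne_zero 8 hp0
  have q16 := pow_ne_zero 16 hp0
  have np : ∀ j : ℕ, -p ^ j ≠ 0 := fun j => neg_ne_zero.2 (pow_ne_zero j hp0)
  have n1 : NotPower p (p ^ 4) := notPower_of_norm_eq hp1 hp0 (k := 1) (by simp)
    (fun n => by push_cast; omega)
  have n2 : NotPower (-p ^ 2) (p ^ 16) := notPower_of_norm_eq hp1 hp0 (k := 2)
    (by rw [norm_neg, norm_pow]; norm_cast) (fun n => by push_cast; omega)
  have n6 : NotPower (-p ^ 6) (p ^ 16) := notPower_of_norm_eq hp1 hp0 (k := 6)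
    (by rw [norm_neg, norm_pow]; norm_cast) (fun n => by push_cast; omega)
  have n18 : NotPower (-p ^ 18) (p ^ 16) := notPower_of_norm_eq hp1 hp0 (k := 18)
    (by rw [norm_neg, norm_pow]; norm_cast) (fun n => by push_cast; omega)
  have nm2 : NotPower (-(p ^ 4)⁻¹ * p ^ 2) (p ^ 16) := notPower_of_norm_eq hp1 hp0 (k := -2)
    (by
      rw [show -(p ^ 4)⁻¹ * p ^ 2 = -(p ^ 2)⁻¹ by field_simp, norm_neg, norm_inv, norm_pow, zpow_neg]
      norm_cast) (fun n => by push_cast; omega)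
  have nn6 : NotPower (-p ^ 6) (p ^ 8) := notPower_of_norm_eq hp1 hp0 (k := 6)
    (by rw [norm_neg, norm_pow]; norm_cast) (fun n => by push_cast; omega)
  have hJ := qPochInf_self_ne_zero h4
  have hJ16 := qPochInf_self_ne_zero h16
  have hθ1 := n1.theta_ne_zero h4 q4 hp0
  have hθ6 := nn6.theta_ne_zero h8 q8 (np 6)
  have e16 : (p ^ 4) ^ 4 = p ^ 16 := by ring
  have e8 : (p ^ 4) ^ 2 = p ^ 8 := by ring
  have e6 : -p ^ 4 * p ^ 2 = -p ^ 6 := by ring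
  have main := thetaProd_mul_appellComb h4 q4 hp0 n1 (by rwa [e16]) (by rwa [e16, e6])
  -- In base p⁴ at x = p one argument is -p⁻². Reflection takes it to -p¹⁸, and the shift by p¹⁶
  -- then to -p².
  have f1 := appell_div h16 q16 (np 18) n18
  rw [show p ^ 16 / -p ^ 18 = -(p ^ 4)⁻¹ * p ^ 2 by field_simp,
    show -p ^ 18 = p ^ 16 * -p ^ 2 by ring, appell_q_mul h16 q16 (np 2) n2] at f1
  rw [thetaProd, appellComb, e16, e8, e6, f1] at main
  have prod := theta_mul_theta_neg_mul_theta hp1 hp0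
  rw [← theta_neg_self_dissection hp1 hp0, g_eq_appell h4 q4 hp0 n1, g_eq_appell h16 q16 (np 2) n2,
    g_eq_appell h16 q16 (np 6) n6]
  generalize appell p (p ^ 4) = A1 at *
  generalize appell (-p ^ 2) (p ^ 16) = A2 at *
  generalize appell (-p ^ 6) (p ^ 16) = A3 at *
  generalize qPochInf (p ^ 4) (p ^ 4) = J at *
  generalize qPochInf (p ^ 16) (p ^ 16) = K at *
  generalize theta p (p ^ 4) = t1 at *
  generalize theta (-p) (p ^ 4) = t2 at *
  generalize theta (-p ^ 6) (p ^ 8) = t3 at *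
  generalize theta (-p ^ 4) (p ^ 8) = t4 at *
  -- The claim is compared after multiplication by the nonzero t1 * t3: the Appell side is the
  -- quadratic relation, the theta side the product identity.
  have hX : t1 * t3 * (p * (A1 * J⁻¹) - (-1 + p ^ 2 * (A2 * K⁻¹) - p ^ 5 * (A3 * K⁻¹))) =
      J ^ 2 * t4 := by
    rw [← main]
    field_simp
    ring
  have hY : t1 * t3 * (t4 * t2 / J) = J ^ 2 * t4 := by
    field_simp
    linear_combination t4 * prod
  have hZ := mul_left_cancel₀ (mul_ne_zero hθ1 hθ6) (hX.trans hY.symm)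
  linear_combination hZ

/-! ### The series ∑ tⁿ (-q; q)_n and its link to g -/

/-- The general term of `∑ (-q; q)_n t^n`. -/
noncomputable def fineTerm (q t : ℂ) (n : ℕ) : ℂ := t ^ n * qPoch (-q) q n

theorem exists_norm_fineTerm_le {q : ℂ} (hq1 : ‖q‖ < 1) :
    ∃ M : ℝ, 0 ≤ M ∧ ∀ t n, ‖fineTerm q t n‖ ≤ ‖t‖ ^ n * M := by
  obtain ⟨M, h0, hM⟩ := exists_norm_le_of_tendsto (tendsto_qPoch hq1 (-q))
  refine ⟨M, h0, fun t n => ?_⟩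
  rw [fineTerm, norm_mul, norm_pow]
  gcongr
  exact hM n

theorem summable_fineTerm {q t : ℂ} (hq1 : ‖q‖ < 1) (ht : ‖t‖ < 1) : Summable (fineTerm q t) := by
  obtain ⟨M, -, hM⟩ := exists_norm_fineTerm_le hq1
  exact Summable.of_norm_bounded
    ((summable_geometric_of_lt_one (norm_nonneg t) ht).mul_right M) (hM t)

theorem exists_norm_tsum_fineTerm_le {q t : ℂ} (hq1 : ‖q‖ < 1) (ht : ‖t‖ < 1) :
    ∃ M : ℝ, 0 ≤ M ∧ ∀ s : ℂ, ‖s‖ ≤ ‖t‖ → ‖∑' n, fineTerm q s n‖ ≤ M := by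
  obtain ⟨M, hM0, hM⟩ := exists_norm_fineTerm_le hq1
  have hs := (summable_geometric_of_lt_one (norm_nonneg t) ht).mul_right M
  refine ⟨∑' n : ℕ, ‖t‖ ^ n * M, tsum_nonneg fun n => by positivity, fun s hst => ?_⟩
  refine tsum_of_norm_bounded hs.hasSum fun n => (hM s n).trans ?_
  gcongr

/-- Split the last factor 1 + q^{n+1} of (-q; q)_{n+1} and sum over n. -/
theorem one_sub_mul_tsum_fineTerm {q t : ℂ} (hq1 : ‖q‖ < 1) (ht : ‖t‖ < 1) :
    (1 - t) * ∑' n, fineTerm q t n = 1 + t * q * ∑' n, fineTerm q (t * q) n := by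
  have htq : ‖t * q‖ < 1 := by
    rw [norm_mul]
    exact mul_lt_one_of_nonneg_of_lt_one_left (norm_nonneg t) ht hq1.le
  have s1 := summable_fineTerm hq1 ht
  have s2 := summable_fineTerm hq1 htq
  have key : ∀ n, fineTerm q t (n + 1) = t * fineTerm q t n + t * q * fineTerm q (t * q) n := by
    intro n
    simp only [fineTerm, qPoch_succ, pow_succ, mul_pow]
    ring
  have h := s1.tsum_eq_zero_add
  rw [tsum_congr key, (s1.mul_left t).tsum_add (s2.mul_left (t * q)), tsum_mul_left,
    tsum_mul_left] at h
  rw [show fineTerm q t 0 = 1 by simp [fineTerm, qPoch_zero]] at h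
  linear_combination h

/-- The general term `p^{n²} / (p; p²)_n`. -/
noncomputable def sqTerm (p : ℂ) (n : ℕ) : ℂ := p ^ (n ^ 2) / qPoch p (p ^ 2) n

theorem sq_pow_mul_ne_one {p : ℂ} (hp1 : ‖p‖ < 1) (i : ℕ) : (p ^ 2) ^ i * p ≠ 1 := by
  intro h
  rw [← pow_mul, ← pow_succ] at h
  have := norm_pow_lt_one hp1 (Nat.succ_ne_zero (2 * i))
  rw [Nat.succ_eq_add_one, h, norm_one] at this
  exact lt_irrefl _ this

/-- The functional equation in base p², applied successively at t = p, p³, p⁵, …. -/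
theorem one_add_mul_tsum_fineTerm {p : ℂ} (hp1 : ‖p‖ < 1) (N : ℕ) :
    1 + p * ∑' n, fineTerm (p ^ 2) p n = ∑ n ∈ Finset.range (N + 1), sqTerm p n +
      p ^ ((N + 1) ^ 2) / qPoch p (p ^ 2) N * ∑' n, fineTerm (p ^ 2) (p * (p ^ 2) ^ N) n := by
  have h2 := norm_pow_lt_one hp1 two_ne_zero
  induction N with
  | zero => simp [sqTerm, qPoch_zero]
  | succ N ih =>
    have hne := qPoch_ne_zero (sq_pow_mul_ne_one hp1) (N + 1)
    have ht : ‖p * (p ^ 2) ^ N‖ < 1 := by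
      rw [← pow_mul, ← pow_succ']
      exact norm_pow_lt_one hp1 (Nat.succ_ne_zero _)
    have h := one_sub_mul_tsum_fineTerm h2 ht
    rw [ih, Finset.sum_range_succ _ (N + 1), sqTerm]
    rw [mul_assoc p ((p ^ 2) ^ N), ← pow_succ (p ^ 2)] at h
    rw [qPoch_succ] at hne ⊢
    have h3 := left_ne_zero_of_mul hne
    have h4 := right_ne_zero_of_mul hne
    rw [mul_comm p ((p ^ 2) ^ N)] at h
    have h5 : ∑' n, fineTerm (p ^ 2) (p * (p ^ 2) ^ N) n =
        (1 + p * (p ^ 2) ^ (N + 1) * ∑' n, fineTerm (p ^ 2) (p * (p ^ 2) ^ (N + 1)) n) /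
          (1 - (p ^ 2) ^ N * p) := by
      rw [← h, mul_div_cancel_left₀ _ h4, mul_comm p ((p ^ 2) ^ N)]
    have h6 : p ^ ((N + 1 + 1) ^ 2) = p ^ ((N + 1) ^ 2) * (p * (p ^ 2) ^ (N + 1)) := by ring
    rw [h5, h6]
    field_simp
    ring

/-- With z = p^{4m+1}, 1 + z / (1 - z) = 1 / (1 - z) merges the pair over (p; p²)_{2m+1}, whose
factors split by exponent modulo 4 into (p; p⁴)_{m+1} (p³; p⁴)_m. -/
theorem sqTerm_even_add_odd {p : ℂ} (hp1 : ‖p‖ < 1) (hp0 : p ≠ 0) (m : ℕ) :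
    sqTerm p (2 * m) + sqTerm p (2 * m + 1) = (p ^ 4) ^ (m ^ 2) / gDenom p (p ^ 4) m := by
  have hne := qPoch_ne_zero (sq_pow_mul_ne_one hp1) (2 * m + 1)
  rw [sqTerm, sqTerm, gDenom, qPoch_succ p (p ^ 4)]
  rw [qPoch_succ] at hne ⊢
  have e := qPoch_two_mul p (p ^ 2) m
  rw [← pow_mul, ← pow_succ] at e
  norm_num at e
  rw [e] at hne ⊢
  have h2 := right_ne_zero_of_mul hne
  have h3 := right_ne_zero_of_mul (left_ne_zero_of_mul hne)
  have h4 := left_ne_zero_of_mul (left_ne_zero_of_mul hne)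
  have e1 : (p ^ 2) ^ (2 * m) = (p ^ 4) ^ m := by rw [← pow_mul, ← pow_mul]; ring
  have e2 : p ^ ((2 * m + 1) ^ 2) = p ^ ((2 * m) ^ 2) * ((p ^ 4) ^ m * p) := by
    rw [← pow_mul]; ring
  have e3 : (p ^ 4) ^ (m ^ 2) = p ^ ((2 * m) ^ 2) := by rw [← pow_mul]; ring
  rw [e1] at h2 ⊢
  rw [e2, e3, show p ^ 4 / p = p ^ 3 by field_simp]
  generalize (p ^ 4) ^ m = y at *
  rw [mul_comm y p] at h2 ⊢
  field_simp
  ring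

theorem sum_range_two_mul_sqTerm {p : ℂ} (hp1 : ‖p‖ < 1) (hp0 : p ≠ 0) (N : ℕ) :
    ∑ n ∈ Finset.range (2 * N), sqTerm p n =
      ∑ m ∈ Finset.range N, (p ^ 4) ^ (m ^ 2) / gDenom p (p ^ 4) m := by
  induction N with
  | zero => simp
  | succ N ih =>
    rw [show 2 * (N + 1) = 2 * N + 1 + 1 by ring, Finset.sum_range_succ, Finset.sum_range_succ, ih,
      Finset.sum_range_succ, add_assoc, sqTerm_even_add_odd hp1 hp0]

theorem mul_tsum_fineTerm_eq_g {p : ℂ} (hp1 : ‖p‖ < 1) (hp0 : p ≠ 0) :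
    p * ∑' n, fineTerm (p ^ 2) p n = p * g p (p ^ 4) := by
  have h2 := norm_pow_lt_one hp1 two_ne_zero
  have h4 := norm_pow_lt_one hp1 four_ne_zero
  have n1 : NotPower p (p ^ 4) := notPower_of_norm_eq hp1 hp0 (k := 1) (by simp)
    (fun n => by push_cast; omega)
  have hs := (gDefined_of_notPower h4 (pow_ne_zero 4 hp0) hp0 n1).2.2
  obtain ⟨M, hM0, hM⟩ := exists_norm_tsum_fineTerm_le h2 hp1
  obtain ⟨K, hK0, hK⟩ := exists_norm_le_of_tendsto ((tendsto_qPoch h2 p).inv₀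
    (qPochInf_ne_zero h2 (sq_pow_mul_ne_one hp1)))
  have hrem : Tendsto (fun N : ℕ => p ^ ((N + 1) ^ 2) / qPoch p (p ^ 2) N *
      ∑' n, fineTerm (p ^ 2) (p * (p ^ 2) ^ N) n) atTop (𝓝 0) := by
    have hb : Tendsto (fun N : ℕ => ‖p‖ ^ N * (K * M)) atTop (𝓝 0) := by
      simpa using (tendsto_pow_atTop_nhds_zero_of_lt_one (norm_nonneg p) hp1).mul_const (K * M)
    refine squeeze_zero_norm (fun N => ?_) hb
    rw [norm_mul, div_eq_mul_inv, norm_mul, norm_pow, mul_assoc]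
    gcongr ?_ * (?_ * ?_)
    · exact pow_le_pow_of_le_one (norm_nonneg p) hp1.le (by nlinarith)
    · exact hK N
    · refine hM _ ?_
      rw [norm_mul]
      exact mul_le_of_le_one_right (norm_nonneg p)
        (by rw [norm_pow]; exact pow_le_one₀ (norm_nonneg _) h2.le)
  have hlim : Tendsto (fun N => ∑ n ∈ Finset.range (N + 1), sqTerm p n) atTop
      (𝓝 (1 + p * ∑' n, fineTerm (p ^ 2) p n)) := by
    have := (tendsto_const_nhds (x := 1 + p * ∑' n, fineTerm (p ^ 2) p n)).sub hrem
    rw [sub_zero] at this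
    exact this.congr fun N => by rw [one_add_mul_tsum_fineTerm hp1 N, add_sub_cancel_right]
  -- Restricting to partial sums of even length makes the pairing exact.
  have hlim2 := ((tendsto_add_atTop_iff_nat (f := fun N => ∑ n ∈ Finset.range N, sqTerm p n) 1).1 hlim).comp
    (tendsto_id.const_mul_atTop' (r := 2) two_pos)
  have h := tendsto_nhds_unique (hlim2.congr fun N => sum_range_two_mul_sqTerm hp1 hp0 N)
    hs.hasSum.tendsto_sum_nat
  rw [g, mul_inv_cancel_left₀ hp0, ← h]
  ring

/-! ### Even and odd parts: φ̄₁ and φ̄₀ -/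

theorem fineTerm_even (p : ℂ) (n : ℕ) : fineTerm (p ^ 2) p (2 * n) = phiBar1Term (p ^ 2) n := by
  rw [fineTerm, phiBar1Term, pow_mul]

theorem fineTerm_odd (p : ℂ) (n : ℕ) :
    fineTerm (p ^ 2) p (2 * n + 1) = p * phiBar0Term (p ^ 2) n := by
  rw [fineTerm, phiBar0Term, pow_succ, pow_mul]
  ring

theorem summable_phiBar1Term {q : ℂ} (hq1 : ‖q‖ < 1) : Summable (phiBar1Term q) := by
  obtain ⟨M, h0, hM⟩ := exists_norm_le_of_tendsto (tendsto_qPoch hq1 (-q))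
  refine Summable.of_norm_bounded ((summable_geometric_of_lt_one (norm_nonneg q) hq1).mul_right M)
    fun n => ?_
  rw [phiBar1Term, norm_mul, norm_pow]
  gcongr
  exact hM _

theorem summable_phiBar0Term {q : ℂ} (hq1 : ‖q‖ < 1) : Summable (phiBar0Term q) := by
  obtain ⟨M, h0, hM⟩ := exists_norm_le_of_tendsto (tendsto_qPoch hq1 (-q))
  refine Summable.of_norm_bounded ((summable_geometric_of_lt_one (norm_nonneg q) hq1).mul_right M)
    fun n => ?_
  rw [phiBar0Term, norm_mul, norm_pow]
  gcongr
  exact hM _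

theorem sq_mul_phiBar0_add {p : ℂ} (hp1 : ‖p‖ < 1) :
    p ^ 2 * phiBar0 (p ^ 2) + p * phiBar1 (p ^ 2) = p * ∑' n, fineTerm (p ^ 2) p n := by
  have h2 := norm_pow_lt_one hp1 two_ne_zero
  rw [← tsum_even_add_odd]
  · simp_rw [fineTerm_even, fineTerm_odd]
    rw [tsum_mul_left, ← phiBar0, ← phiBar1]
    ring
  · simp_rw [fineTerm_even]
    exact summable_phiBar1Term h2
  · simp_rw [fineTerm_odd]
    exact (summable_phiBar0Term h2).mul_left p

theorem Jsingle_two {q : ℂ} (hq1 : ‖q‖ < 1) (hq0 : q ≠ 0) :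
    Jsingle 2 q = qPochInf (q ^ 2) (q ^ 2) := by
  rw [← theta_self_cube (norm_pow_lt_one hq1 two_ne_zero) (pow_ne_zero 2 hq0), Jsingle, J, ← pow_mul,
    zpow_natCast]

/-- Both identities at once, in terms of a square root `p` of `q`. -/
theorem sq_mul_phiBar0_add_eq {p q : ℂ} (hpq : p ^ 2 = q) (hp1 : ‖p‖ < 1) (hp0 : p ≠ 0) :
    q * phiBar0 q + p * phiBar1 q =
      -1 + q * g (-q) (q ^ 8) - p * q ^ 2 * g (-q ^ 3) (q ^ 8) +
        Jbar 2 4 q * (Jbar 3 8 q + p * Jbar 1 8 q) / Jsingle 2 q := by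
  subst hpq
  rw [sq_mul_phiBar0_add hp1, mul_tsum_fineTerm_eq_g hp1 hp0, mul_g_self_eq hp1 hp0,
    Jsingle_two (norm_pow_lt_one hp1 two_ne_zero) (pow_ne_zero 2 hp0), Jbar, Jbar, Jbar, zpow_one,
    show ((p ^ 2) ^ (2 : ℤ)) = p ^ 4 by norm_cast; ring,
    show ((p ^ 2) ^ (3 : ℤ)) = p ^ 6 by norm_cast; ring]
  simp only [← pow_mul, Nat.reduceMul]
  ring

end MockTheta

/-- For `0 < |q| < 1`, the two identities, each together with the assertion that all the series
in it converge and that no denominator in it vanishes. -/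
theorem theorem1p6 (q : ℂ) (hq0 : q ≠ 0) (hq1 : ‖q‖ < 1) :
    MockTheta.Jsingle 2 q ≠ 0 ∧
    (Summable (MockTheta.phiBar0Term q) ∧
      MockTheta.GDefined (-q) (q ^ 8) ∧
      q * MockTheta.phiBar0 q =
        -1 + q * MockTheta.g (-q) (q ^ 8)
          + MockTheta.Jbar 2 4 q * MockTheta.Jbar 3 8 q / MockTheta.Jsingle 2 q) ∧
    (Summable (MockTheta.phiBar1Term q) ∧
      MockTheta.GDefined (-q ^ 3) (q ^ 8) ∧
      MockTheta.phiBar1 q =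
        -q ^ 2 * MockTheta.g (-q ^ 3) (q ^ 8)
          + MockTheta.Jbar 2 4 q * MockTheta.Jbar 1 8 q / MockTheta.Jsingle 2 q) := by
  have h8 := MockTheta.norm_pow_lt_one hq1 (n := 8) (by norm_num)
  have q8 := pow_ne_zero 8 hq0
  obtain ⟨p, hp⟩ : ∃ p : ℂ, p ^ 2 = q := IsAlgClosed.exists_pow_nat_eq q two_pos
  have hp0 : p ≠ 0 := by
    rintro rfl
    exact hq0 (by rw [← hp]; simp)
  have hp1 : ‖p‖ < 1 := by
    rw [← hp, norm_pow] at hq1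
    exact (pow_lt_one_iff_of_nonneg (norm_nonneg p) two_ne_zero).1 hq1
  have hplus := MockTheta.sq_mul_phiBar0_add_eq hp hp1 hp0
  -- At the other square root only the explicit factors p change sign, so the half sum and half
  -- difference isolate the two identities, the second up to the factor p.
  have hminus := MockTheta.sq_mul_phiBar0_add_eq (p := -p) (by rw [neg_sq, hp])
    (by rwa [norm_neg]) (neg_ne_zero.2 hp0)
  refine ⟨?_, ⟨MockTheta.summable_phiBar0Term hq1, ?_, ?_⟩,
    MockTheta.summable_phiBar1Term hq1, ?_, ?_⟩
  · rw [MockTheta.Jsingle_two hq1 hq0]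
    exact MockTheta.qPochInf_self_ne_zero (MockTheta.norm_pow_lt_one hq1 two_ne_zero)
  · exact MockTheta.gDefined_of_notPower h8 q8 (neg_ne_zero.2 hq0)
      (MockTheta.notPower_of_norm_eq hq1 hq0 (k := 1) (by simp) fun n => by push_cast; omega)
  · linear_combination (1 / 2 : ℂ) * hplus + (1 / 2 : ℂ) * hminus
  · exact MockTheta.gDefined_of_notPower h8 q8 (neg_ne_zero.2 (pow_ne_zero 3 hq0))
      (MockTheta.notPower_of_norm_eq hq1 hq0 (k := 3) (by rw [norm_neg, norm_pow]; norm_cast)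
        fun n => by push_cast; omega)
  · refine mul_left_cancel₀ hp0 ?_
    linear_combination (1 / 2 : ℂ) * hplus - (1 / 2 : ℂ) * hminus
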